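/- Conventions. For a metric space $(X,d)$, $A\subseteq X$ and $r>0$, the Rips complex $P_r(A)$ is the simplicial complex with vertex set $A$ in which a finite nonempty set spans a simplex iff its points are pairwise at distance $\le r$. A metric space $X$ is \emph{asymptotically hereditarily aspherical} (AHA) if for every $r>0$ there is $R>0$ such that for every $A\subseteq X$, every $i\ge 2$, and every simplicial map $f\colon S\to P_r(A)$ from a triangulation $S$ of the $i$-sphere, there are a triangulation $B$ of the $(i+1)$-ball with $\partial B=S$ and a simplicial map $F\colon B\to P_R(A)$ extending $f$. A group is AHA if it is finitely generated and is AHA as a metric space with the word metric of some (equivalently, every) finite generating set. A (possibly disconnected) space $Z$ is \emph{aspherical} if for every $k\ge2$ every continuous map $S^k\to Z$ extends continuously over the ball $B^{k+1}$. For a loop $f\colon S^1\to X$, let $\mathrm{fill\text{-}rad}(f)$ be the infimum, over all continuous extensions $F\colon D^2\to X$ of $f$, of the maximal distance of a point of $F(D^2)$ from $f(S^1)$; for $r>0$, let $\mathrm{fill\text{-}rad}(r)\in[0,\infty]$ be the supremum of $\mathrm{fill\text{-}rad}(f)$ over all piecewise geodesic loops $f$ in $X$ of length $\le r$. For a real number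 $D$, $N_D(A)$ is the set of points at distance $\le D$ from $A$. A \emph{metric complex} is a metric space with a CW complex structure inducing the metric topology. A \emph{geometric} action is an action by isometries that is properly discontinuous (for all compact $K,L\subseteq X$ only finitely many $g$ satisfy $gK\cap L\ne\emptyset$) and cocompact. \textbf{Theorem A.} Let $X$ be a simply connected geodesic metric space, and suppose that to each subset $A\subseteq X$ there is assigned a subset $Y_A\subseteq X$ such that, for some real number $D$ independent of $A$: (a) $A\subseteq Y_A\subseteq N_D(A)$ for every $A$; (b) $Y_A$ is aspherical for every $A$; (c) if $A_1\subseteq A_2$ then $Y_{A_1}\subseteq Y_{A_2}$. Then: (1) if $\mathrm{fill\text{-}rad}(r)<\infty$ for every $r>0$, then $X$ is AHA; (2) if $X$ is a metric complex on which a group $G$ acts geometrically, and every $Y_A$ is a subcomplex of $X$, then $X$ is AHA, and so is $G$ (in particular $G$ is finitely generated). -/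

import Mathlib

open Metric
open scoped ENNReal

noncomputable section

/-! ### Simplicial complexes, triangulated spheres and balls -/

/-- The geometric realization of an abstract simplicial complex, in barycentric coordinates:
nonnegative weights of total mass one carried by a simplex. It is topologized as a subspace of the
product `ι → ℝ`; it is only used for finite complexes, where this is the usual topology. -/
def realization {ι : Type*} (K : PreAbstractSimplicialComplex ι) : Set (ι → ℝ) :=
  {w | ∃ s ∈ K.faces, (∀ v, 0 ≤ w v) ∧ (∀ v, v ∉ s → w v = 0) ∧ ∑ v ∈ s, w v = 1}

open Classical in
/-- A map on vertices is simplicial if it sends simplices onto simplices. -/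
def IsSimplicialMap {ι κ : Type*} (K : PreAbstractSimplicialComplex ι)
    (L : PreAbstractSimplicialComplex κ) (f : ι → κ) : Prop :=
  ∀ s ∈ K.faces, s.image f ∈ L.faces

/-- `S` is a triangulation of the `n`-sphere: a finite simplicial complex whose realization is
homeomorphic to the unit sphere of `ℝⁿ⁺¹`. (The vertices of a finite complex are labelled by natural
numbers, which is no restriction up to isomorphism.) -/
def IsSphereTriangulation (n : ℕ) (S : PreAbstractSimplicialComplex ℕ) : Prop :=
  S.faces.Finite ∧
    Nonempty (realization S ≃ₜ sphere (0 : EuclideanSpace ℝ (Fin (n + 1))) 1)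

/-- `B` is a triangulation of the `n`-ball with `∂B = S`: a finite simplicial complex containing `S`
as a subcomplex, with a homeomorphism from its realization to the closed unit ball of `ℝⁿ` under
which the realization of `S` corresponds to the boundary sphere. -/
def IsBallTriangulation (n : ℕ) (B S : PreAbstractSimplicialComplex ℕ) : Prop :=
  B.faces.Finite ∧ S ≤ B ∧
    ∃ h : realization B ≃ₜ closedBall (0 : EuclideanSpace ℝ (Fin n)) 1,
      ∀ x : realization B,
        (h x : EuclideanSpace ℝ (Fin n)) ∈ sphere (0 : EuclideanSpace ℝ (Fin n)) 1 ↔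
          (x : ℕ → ℝ) ∈ realization S

/-! ### Asymptotic hereditary asphericity -/

/-- The Rips complex `P_r(A)` of a subset `A` of a metric space: vertices are the points of `A`, and
a finite nonempty set of vertices spans a simplex iff its points are pairwise at distance `≤ r`. -/
def ripsComplex {X : Type*} [MetricSpace X] (r : ℝ) (A : Set X) :
    PreAbstractSimplicialComplex X where
  faces := {s | s.Nonempty ∧ (s : Set X) ⊆ A ∧ ∀ x ∈ s, ∀ y ∈ s, dist x y ≤ r}
  isRelLowerSet_faces := fun _ hs => ⟨hs.1, fun _ hts ht =>
    ⟨ht, fun _ hx => hs.2.1 (hts hx), fun x hx y hy => hs.2.2 x (hts hx) y (hts hy)⟩⟩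

/-- `C` is `(i; r, R)`-aspherical in `D`: every simplicial map from a triangulated `i`-sphere to
`P_r(C)` has a simplicial extension, from some triangulated `(i+1)`-ball with that boundary, to
`P_R(D)`. -/
def IsCoarselyAsphericalIn {X : Type*} [MetricSpace X] (i : ℕ) (r R : ℝ) (C D : Set X) : Prop :=
  ∀ (S : PreAbstractSimplicialComplex ℕ) (f : ℕ → X),
    IsSphereTriangulation i S → IsSimplicialMap S (ripsComplex r C) f →
      ∃ (B : PreAbstractSimplicialComplex ℕ) (F : ℕ → X),
        IsBallTriangulation (i + 1) B S ∧ IsSimplicialMap B (ripsComplex R D) F ∧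
          ∀ v, {v} ∈ S.faces → F v = f v

/-- Asymptotically hereditarily aspherical metric spaces. -/
def IsAHA (X : Type*) [MetricSpace X] : Prop :=
  ∀ r : ℝ, 0 < r → ∃ R : ℝ, 0 < R ∧
    ∀ A : Set X, ∀ i : ℕ, 2 ≤ i → IsCoarselyAsphericalIn i r R A A

/-! ### Word metrics and AHA groups -/

/-- The word length of `g` with respect to `S`: the least length of a word in letters from
`S ∪ S⁻¹` with product `g`. -/
def wordLength {G : Type*} [Group G] (S : Set G) (g : G) : ℕ :=
  sInf {n | ∃ l : List G, l.length = n ∧ (∀ x ∈ l, x ∈ S ∨ x⁻¹ ∈ S) ∧ l.prod = g}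

theorem exists_word {G : Type*} [Group G] {S : Set G} (hS : Subgroup.closure S = ⊤) (g : G) :
    ∃ l : List G, l.length = wordLength S g ∧ (∀ x ∈ l, x ∈ S ∨ x⁻¹ ∈ S) ∧ l.prod = g := by
  have hg : g ∈ (Subgroup.closure S).toSubmonoid := by rw [hS]; trivial
  rw [Subgroup.closure_toSubmonoid] at hg
  obtain ⟨l, hl, hp⟩ := Submonoid.exists_list_of_mem_closure hg
  exact Nat.sInf_mem (s := {n | ∃ l : List G, l.length = n ∧ (∀ x ∈ l, x ∈ S ∨ x⁻¹ ∈ S) ∧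
    l.prod = g}) ⟨l.length, l, rfl, hl, hp⟩

theorem wordLength_le {G : Type*} [Group G] {S : Set G} (l : List G)
    (hl : ∀ x ∈ l, x ∈ S ∨ x⁻¹ ∈ S) : wordLength S l.prod ≤ l.length :=
  Nat.sInf_le ⟨l, rfl, hl, rfl⟩

theorem wordLength_inv_le {G : Type*} [Group G] {S : Set G} (hS : Subgroup.closure S = ⊤) (g : G) :
    wordLength S g⁻¹ ≤ wordLength S g := by
  obtain ⟨l, h1, h2, h3⟩ := exists_word hS g
  have := wordLength_le (S := S) (l.map (fun x => x⁻¹)).reverse (by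
    intro x hx
    simp only [List.mem_reverse, List.mem_map] at hx
    obtain ⟨y, hy, rfl⟩ := hx
    rw [inv_inv]
    exact (h2 y hy).symm)
  rwa [← List.prod_inv_reverse, h3, List.length_reverse, List.length_map, h1] at this

/-- The word metric `d_S(g, h) = |g⁻¹h|_S` on a group generated by `S`. -/
@[reducible]
def wordMetricSpace {G : Type*} [Group G] (S : Set G) (hS : Subgroup.closure S = ⊤) :
    MetricSpace G where
  dist g h := wordLength S (g⁻¹ * h)
  dist_self g := by
    have := wordLength_le (S := S) [] (by simp)
    simpa using this
  dist_comm g h := by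
    have h1 := wordLength_inv_le hS (g⁻¹ * h)
    have h2 := wordLength_inv_le hS (h⁻¹ * g)
    simp only [mul_inv_rev, inv_inv] at h1 h2
    exact_mod_cast le_antisymm h2 h1
  dist_triangle g h k := by
    obtain ⟨l, h1, h2, h3⟩ := exists_word hS (g⁻¹ * h)
    obtain ⟨m, k1, k2, k3⟩ := exists_word hS (h⁻¹ * k)
    have := wordLength_le (S := S) (l ++ m) (by
      intro x hx
      rcases List.mem_append.1 hx with hx | hx
      exacts [h2 x hx, k2 x hx])
    rw [List.prod_append, h3, k3, List.length_append, h1, k1] at this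
    have e : g⁻¹ * h * (h⁻¹ * k) = g⁻¹ * k := by group
    rw [e] at this
    exact_mod_cast this
  eq_of_dist_eq_zero := by
    intro g h hgh
    obtain ⟨l, h1, -, h3⟩ := exists_word hS (g⁻¹ * h)
    have h0 : wordLength S (g⁻¹ * h) = 0 := by exact_mod_cast hgh
    rw [h0, List.length_eq_zero_iff] at h1
    subst h1
    rw [List.prod_nil] at h3
    exact inv_mul_eq_one.1 h3.symm

/-- A group is AHA if it is finitely generated and AHA as a metric space with the word metric of
every finite generating set. -/
def IsAHAGroup (G : Type*) [Group G] : Prop :=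
  Group.FG G ∧ ∀ (S : Finset G) (hS : Subgroup.closure (S : Set G) = ⊤),
    @IsAHA G (wordMetricSpace (S : Set G) hS)

/-! ### Aspherical spaces -/

/-- A space is aspherical if every continuous map from a sphere of dimension `k ≥ 2` extends
continuously over the ball, i.e. all homotopy groups `π_k`, `k ≥ 2`, vanish at all base points.
The space may be disconnected. -/
def IsAspherical (Z : Type*) [TopologicalSpace Z] : Prop :=
  ∀ k : ℕ, 2 ≤ k → ∀ f : C(sphere (0 : EuclideanSpace ℝ (Fin (k + 1))) 1, Z),
    ∃ F : C(closedBall (0 : EuclideanSpace ℝ (Fin (k + 1))) 1, Z),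
      ∀ (x : closedBall (0 : EuclideanSpace ℝ (Fin (k + 1))) 1)
        (y : sphere (0 : EuclideanSpace ℝ (Fin (k + 1))) 1),
        (x : EuclideanSpace ℝ (Fin (k + 1))) = y → F x = f y

/-! ### Geodesic spaces and the filling radius function -/

/-- Any two points are joined by a geodesic segment. -/
def IsGeodesicSpace (X : Type*) [MetricSpace X] : Prop :=
  ∀ x y : X, ∃ γ : ℝ → X, γ 0 = x ∧ γ (dist x y) = y ∧
    ∀ s ∈ Set.Icc 0 (dist x y), ∀ t ∈ Set.Icc 0 (dist x y), dist (γ s) (γ t) = |s - t|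

/-- The parametrization of a loop by `[0, 1]`. -/
def loopParam {X : Type*} [TopologicalSpace X] (f : C(Circle, X)) (t : ℝ) : X :=
  f (Circle.exp (2 * Real.pi * t))

/-- A loop is piecewise geodesic if its parameter interval has a finite subdivision such that the
loop is a geodesic segment, parametrized proportionally to arc length, on each piece. -/
def IsPiecewiseGeodesic {X : Type*} [MetricSpace X] (f : C(Circle, X)) : Prop :=
  ∃ (n : ℕ) (t : ℕ → ℝ), Monotone t ∧ t 0 = 0 ∧ t n = 1 ∧ ∀ i < n, ∃ v : ℝ,
    ∀ a ∈ Set.Icc (t i) (t (i + 1)), ∀ b ∈ Set.Icc (t i) (t (i + 1)),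
      dist (loopParam f a) (loopParam f b) = v * |a - b|

/-- The length of a loop. -/
def loopLength {X : Type*} [MetricSpace X] (f : C(Circle, X)) : ℝ≥0∞ :=
  eVariationOn (loopParam f) (Set.Icc 0 1)

/-- `F : D² → X` extends the loop `f`. -/
def ExtendsLoop {X : Type*} [TopologicalSpace X] (F : C(closedBall (0 : ℂ) 1, X))
    (f : C(Circle, X)) : Prop :=
  ∀ (w : closedBall (0 : ℂ) 1) (z : Circle), (w : ℂ) = z → F w = f z

/-- The filling radius of a loop: the infimum, over all extensions `F` to the disk, of the maximal
distance of a point of the image of `F` from the image of the loop. -/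
def loopFillRad {X : Type*} [MetricSpace X] (f : C(Circle, X)) : ℝ≥0∞ :=
  ⨅ (F : C(closedBall (0 : ℂ) 1, X)) (_ : ExtendsLoop F f),
    ⨆ w : closedBall (0 : ℂ) 1, infEDist (F w) (Set.range f)

/-- The filling radius function: the supremum of the filling radii of all piecewise geodesic loops
of length at most `r`. -/
def fillRad (X : Type*) [MetricSpace X] (r : ℝ) : ℝ≥0∞ :=
  ⨆ (f : C(Circle, X)) (_ : IsPiecewiseGeodesic f) (_ : loopLength f ≤ ENNReal.ofReal r),
    loopFillRad f

/-! ### Complexes and geometric actions -/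

/-- `Z` is (the underlying set of) a subcomplex of the CW complex `X`. -/
def IsSubcomplex {X : Type*} [TopologicalSpace X] [Topology.CWComplex (Set.univ : Set X)]
    (Z : Set X) : Prop :=
  ∃ E : Topology.CWComplex.Subcomplex (Set.univ : Set X), (E : Set X) = Z

/-- A geometric action: by isometries, properly discontinuous and cocompact. -/
structure IsGeometricAction (G X : Type*) [Group G] [MetricSpace X] [MulAction G X] : Prop where
  isometric : ∀ (g : G) (x y : X), dist (g • x) (g • y) = dist x y
  properlyDiscontinuous : ProperlyDiscontinuousSMul G X
  cocompact : ∃ K : Set X, IsCompact K ∧ ∀ x : X, ∃ g : G, ∃ y ∈ K, g • y = x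

end

/-! Let `S` triangulate the `i`-sphere, `i ≥ 2`, and let `f` send its vertices to `A`, adjacent ones
to points at distance at most `r`. The map is made continuous skeleton by skeleton. Edges become
paths, and triangles are filled within a distance `C` depending only on `r` (`Fillings`). A simplex
`s` with at least four vertices is filled, by asphericity, inside `Y` of the `C`-neighbourhood of
`f(s)`; monotonicity of `Y` puts the image of its boundary there (`Fillings.exists_map`). The whole
sphere now lies in `Y` of the `C`-neighbourhood of `A`, so asphericity extends the map over the
ball. Triangulate the ball finely and label each interior vertex by a point of `A` near its image:
adjacent labels are boundedly close.

The difficulty is that the boundary must remain `S` and cannot be subdivided. The cone on `S` is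
therefore given a collar: its inner vertices are positioned in `S` itself, so that every face
meeting the boundary sits in a single simplex `s` of `S` (`exists_collar`). There the continuous map
stays near `f(s)`, which has diameter at most `r`, and the labels are close although the edges may
be long. Edges between interior vertices are made short by repeatedly bisecting a longest one
(`exists_fine_isPositioned`). `isAHA_of_fillings` combines these constructions.

The two cases differ only in the source of the triangle fillings. In the first, geodesic triangles
have perimeter at most `3 * r`, and the filling radius bounds their fillings. In the second, every
point is replaced by a nearby orbit point; up to translation only finitely many triangles occur, and
each is filled by simple connectedness. Finally, the orbit map controls distances in both
directions, which carries the property over to the group; finite generation comes from the same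
finiteness statement, a Milnor–Schwarz argument. -/

/-! ### Geometric simplices in barycentric coordinates -/

/-- The geometric simplex spanned by a finite set of vertices. -/
def geomSimplex (s : Finset ℕ) : Set (ℕ → ℝ) :=
  {w | (∀ v, 0 ≤ w v) ∧ (∀ v, v ∉ s → w v = 0) ∧ ∑ v ∈ s, w v = 1}

theorem mem_realization_iff {K : PreAbstractSimplicialComplex ℕ} {w : ℕ → ℝ} :
    w ∈ realization K ↔ ∃ s ∈ K.faces, w ∈ geomSimplex s := Iff.rfl

theorem geomSimplex_subset_realization {K : PreAbstractSimplicialComplex ℕ} {s : Finset ℕ}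
    (hs : s ∈ K.faces) : geomSimplex s ⊆ realization K := fun _ hw => ⟨s, hs, hw⟩

theorem realization_eq_iUnion (K : PreAbstractSimplicialComplex ℕ) :
    realization K = ⋃ s ∈ K.faces, geomSimplex s := by
  ext w; simp [mem_realization_iff]

theorem geomSimplex_mono {s t : Finset ℕ} (h : s ⊆ t) : geomSimplex s ⊆ geomSimplex t := by
  rintro w ⟨h0, h1, h2⟩
  refine ⟨h0, fun v hv => h1 v fun hs => hv (h hs), ?_⟩
  rw [← h2]
  exact (Finset.sum_subset h fun v _ hv => h1 v hv).symm

theorem mem_geomSimplex_of_subset {s t : Finset ℕ} {w : ℕ → ℝ} (hw : w ∈ geomSimplex t)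
    (hst : s ⊆ t) (h : ∀ v ∈ t, v ∉ s → w v = 0) : w ∈ geomSimplex s := by
  obtain ⟨h0, h1, h2⟩ := hw
  refine ⟨h0, fun v hv => ?_, ?_⟩
  · by_cases hvt : v ∈ t
    · exact h v hvt hv
    · exact h1 v hvt
  · rw [← h2]
    exact Finset.sum_subset hst fun v hvt hv => h v hvt hv

/-- The support of a point lies in every simplex carrying it, so simplices meet only in common
faces. Compatibility of glued maps is thereby reduced to agreement on faces. -/
theorem geomSimplex_inter {s t : Finset ℕ} {w : ℕ → ℝ} (hs : w ∈ geomSimplex s)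
    (ht : w ∈ geomSimplex t) : w ∈ geomSimplex (s ∩ t) := by
  refine mem_geomSimplex_of_subset hs Finset.inter_subset_left fun v hv hvt => ?_
  exact ht.2.1 v fun h => hvt (Finset.mem_inter.2 ⟨hv, h⟩)

theorem nonempty_of_mem_geomSimplex {s : Finset ℕ} {w : ℕ → ℝ} (hs : w ∈ geomSimplex s) :
    s.Nonempty := by
  rcases s.eq_empty_or_nonempty with rfl | h
  · have := hs.2.2
    simp at this
  · exact h

theorem le_one_of_mem_geomSimplex {s : Finset ℕ} {w : ℕ → ℝ} (hs : w ∈ geomSimplex s) (v : ℕ) :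
    w v ≤ 1 := by
  by_cases hv : v ∈ s
  · rw [← hs.2.2]
    exact Finset.single_le_sum (fun u _ => hs.1 u) hv
  · rw [hs.2.1 v hv]
    exact zero_le_one

theorem isClosed_geomSimplex (s : Finset ℕ) : IsClosed (geomSimplex s) := by
  have : geomSimplex s = (⋂ v, {w | 0 ≤ w v}) ∩ (⋂ v ∈ {v | v ∉ s}, {w | w v = 0}) ∩
      {w | ∑ v ∈ s, w v = 1} := by
    ext w
    simp [geomSimplex, and_assoc]
  rw [this]
  refine ((isClosed_iInter fun v => ?_).inter (isClosed_biInter fun v _ => ?_)).inter ?_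
  · exact isClosed_le continuous_const (continuous_apply v)
  · exact isClosed_eq (continuous_apply v) continuous_const
  · exact isClosed_eq (continuous_finsetSum _ fun v _ => continuous_apply v) continuous_const

theorem isCompact_geomSimplex (s : Finset ℕ) : IsCompact (geomSimplex s) := by
  refine (isCompact_univ_pi (s := fun _ : ℕ => Set.Icc (0 : ℝ) 1)
    fun _ => isCompact_Icc).of_isClosed_subset (isClosed_geomSimplex s)
    fun w hw v _ => ⟨hw.1 v, le_one_of_mem_geomSimplex hw v⟩

theorem isCompact_realization {K : PreAbstractSimplicialComplex ℕ} (hK : K.faces.Finite) :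
    IsCompact (realization K) := by
  rw [realization_eq_iUnion]
  exact hK.isCompact_biUnion fun s _ => isCompact_geomSimplex s

theorem single_mem_geomSimplex {v : ℕ} {s : Finset ℕ} :
    (Pi.single v 1 : ℕ → ℝ) ∈ geomSimplex s ↔ v ∈ s := by
  constructor
  · intro h
    by_contra hv
    have := h.2.1 v hv
    simp at this
  · intro h
    refine ⟨fun u => ?_, fun u hu => ?_, ?_⟩
    · by_cases huv : u = v
      · subst huv; simp
      · simp [Pi.single_eq_of_ne huv]
    · have : u ≠ v := by rintro rfl; exact hu h
      simp [Pi.single_eq_of_ne this]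
    · simp [h]

theorem eq_single_of_mem_geomSimplex {v : ℕ} {w : ℕ → ℝ} (hw : w ∈ geomSimplex {v}) :
    w = Pi.single v 1 := by
  ext u
  by_cases huv : u = v
  · subst huv
    simpa using hw.2.2
  · rw [Pi.single_eq_of_ne huv]
    exact hw.2.1 u (by simpa using huv)

theorem convex_geomSimplex (s : Finset ℕ) : Convex ℝ (geomSimplex s) := by
  intro x hx y hy a b ha hb hab
  refine ⟨fun v => ?_, fun v hv => ?_, ?_⟩
  · have := hx.1 v
    have := hy.1 v
    simp only [Pi.add_apply, Pi.smul_apply, smul_eq_mul]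
    positivity
  · simp [hx.2.1 v hv, hy.2.1 v hv]
  · simp only [Pi.add_apply, Pi.smul_apply, smul_eq_mul]
    rw [Finset.sum_add_distrib, ← Finset.mul_sum, ← Finset.mul_sum, hx.2.2, hy.2.2]
    linarith

/-- The vertices of a complex. -/
def vertexSet (K : PreAbstractSimplicialComplex ℕ) : Set ℕ := {v | {v} ∈ K.faces}

theorem face_subset {K : PreAbstractSimplicialComplex ℕ} {s t : Finset ℕ} (hs : s ∈ K.faces)
    (h : t ⊆ s) (ht : t.Nonempty) : t ∈ K.faces :=
  (K.isRelLowerSet_faces hs).2 h ht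

theorem face_nonempty {K : PreAbstractSimplicialComplex ℕ} {s : Finset ℕ} (hs : s ∈ K.faces) :
    s.Nonempty :=
  (K.isRelLowerSet_faces hs).1

theorem mem_vertexSet {K : PreAbstractSimplicialComplex ℕ} {s : Finset ℕ} (hs : s ∈ K.faces)
    {v : ℕ} (hv : v ∈ s) : v ∈ vertexSet K :=
  face_subset hs (by simpa using hv) (by simp)

theorem finite_vertexSet {K : PreAbstractSimplicialComplex ℕ} (hK : K.faces.Finite) :
    (vertexSet K).Finite :=
  Set.Finite.of_finite_image (f := fun v => ({v} : Finset ℕ))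
    (hK.subset (by rintro _ ⟨v, hv, rfl⟩; exact hv)) Finset.singleton_injective.injOn

theorem exists_fresh {K : PreAbstractSimplicialComplex ℕ} (hK : K.faces.Finite) :
    ∃ m, m ∉ vertexSet K :=
  (finite_vertexSet hK).exists_notMem

theorem eq_zero_of_mem_realization {K : PreAbstractSimplicialComplex ℕ} {w : ℕ → ℝ}
    (hw : w ∈ realization K) {v : ℕ} (hv : v ∉ vertexSet K) : w v = 0 := by
  obtain ⟨s, hs, hws⟩ := hw
  exact hws.2.1 v fun h => hv (mem_vertexSet hs h)

/-- Compatible continuous maps on finitely many geometric simplices can be glued. -/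
theorem exists_glue {X : Type*} [TopologicalSpace X] [Nonempty X] {T : Set (Finset ℕ)}
    (hT : T.Finite) (φ : Finset ℕ → (ℕ → ℝ) → X)
    (hφ : ∀ s ∈ T, ContinuousOn (φ s) (geomSimplex s))
    (hcomp : ∀ s ∈ T, ∀ t ∈ T, ∀ w ∈ geomSimplex s, w ∈ geomSimplex t → φ s w = φ t w) :
    ∃ F : (ℕ → ℝ) → X, ContinuousOn F (⋃ s ∈ T, geomSimplex s) ∧
      ∀ s ∈ T, Set.EqOn F (φ s) (geomSimplex s) := by
  classical
  let F : (ℕ → ℝ) → X := fun w =>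
    if h : ∃ s ∈ T, w ∈ geomSimplex s then φ h.choose w else Classical.arbitrary X
  have hF : ∀ s ∈ T, Set.EqOn F (φ s) (geomSimplex s) := by
    intro s hs w hw
    have h : ∃ s ∈ T, w ∈ geomSimplex s := ⟨s, hs, hw⟩
    simp only [F, dif_pos h]
    exact hcomp _ h.choose_spec.1 _ hs _ h.choose_spec.2 hw
  refine ⟨F, ?_, hF⟩
  have : Finite T := hT
  rw [Set.biUnion_eq_iUnion]
  refine (locallyFinite_of_finite _).continuousOn_iUnion (fun s => isClosed_geomSimplex _)
    fun s => ?_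
  exact (hφ _ s.2).congr (hF _ s.2)

/-! ### Bisecting an edge -/

/-- The complex obtained from `K` by bisecting the edge `{a, b}` with the new vertex `m`. -/
def bisect (K : PreAbstractSimplicialComplex ℕ) (a b m : ℕ) : PreAbstractSimplicialComplex ℕ where
  -- Faces avoiding `m` are the old ones not containing the whole edge. A face through `m` comes
  -- from the star of the edge: exchanging `m` for both ends must give a face of `K`.
  faces := {t | t.Nonempty ∧ ¬ ({a, b} ⊆ t) ∧
    (if m ∈ t then t.erase m ∪ {a, b} else t) ∈ K.faces}
  isRelLowerSet_faces := by
    rintro t ⟨h1, h2, h3⟩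
    refine ⟨h1, fun s hst hs => ⟨hs, fun h => h2 (h.trans hst), ?_⟩⟩
    by_cases hm : m ∈ s
    · rw [if_pos hm]
      rw [if_pos (hst hm)] at h3
      exact face_subset h3 (Finset.union_subset_union (Finset.erase_subset_erase m hst) subset_rfl)
        ⟨a, by simp⟩
    · rw [if_neg hm]
      refine face_subset h3 ?_ hs
      split_ifs with h
      · exact (Finset.subset_erase.2 ⟨hst, hm⟩).trans Finset.subset_union_left
      · exact hst

theorem mem_bisect_of_mem {K : PreAbstractSimplicialComplex ℕ} {a b m : ℕ} {t : Finset ℕ}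
    (ht : t ∈ (bisect K a b m).faces) (hm : m ∈ t) : t.erase m ∪ {a, b} ∈ K.faces := by
  simpa [hm] using ht.2.2

theorem mem_bisect_of_notMem {K : PreAbstractSimplicialComplex ℕ} {a b m : ℕ} {t : Finset ℕ}
    (ht : t ∈ (bisect K a b m).faces) (hm : m ∉ t) : t ∈ K.faces := by
  simpa [hm] using ht.2.2

theorem bisect_comm (K : PreAbstractSimplicialComplex ℕ) (a b m : ℕ) :
    bisect K a b m = bisect K b a m := by
  ext t
  simp [bisect, Finset.pair_comm a b]

theorem finite_bisect {K : PreAbstractSimplicialComplex ℕ} (hK : K.faces.Finite) (a b m : ℕ) :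
    (bisect K a b m).faces.Finite := by
  have : (bisect K a b m).faces ⊆ ⋃ s ∈ K.faces, ((insert m s).powerset : Set (Finset ℕ)) := by
    intro t ht
    simp only [Set.mem_iUnion, Finset.mem_coe, Finset.mem_powerset]
    by_cases hm : m ∈ t
    · refine ⟨_, mem_bisect_of_mem ht hm, ?_⟩
      rw [← Finset.insert_union, Finset.insert_erase hm]
      exact Finset.subset_union_left
    · exact ⟨_, mem_bisect_of_notMem ht hm, Finset.subset_insert _ _⟩
  exact (hK.biUnion fun s _ => Finset.finite_toSet _).subset this

/-- The direction in which mass is moved when the edge `{a, b}` is bisected by `m`. -/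
noncomputable def bisectDir (a b m : ℕ) : ℕ → ℝ :=
  (2 : ℝ) • Pi.single m 1 - Pi.single a 1 - Pi.single b 1

theorem sum_bisectDir {a b m : ℕ} {s : Finset ℕ} (ha : a ∈ s) (hb : b ∈ s) (hm : m ∈ s) :
    ∑ v ∈ s, bisectDir a b m v = 0 := by
  have h : ∀ u ∈ s, ∑ v ∈ s, (Pi.single u 1 : ℕ → ℝ) v = 1 := fun u hu =>
    (single_mem_geomSimplex.2 hu).2.2
  simp only [bisectDir, Pi.sub_apply, Pi.smul_apply, smul_eq_mul, Finset.sum_sub_distrib,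
    ← Finset.mul_sum, h a ha, h b hb, h m hm]
  norm_num

theorem bisectDir_comm (a b m : ℕ) : bisectDir a b m = bisectDir b a m := by
  simp only [bisectDir]; abel

theorem bisectDir_left {a b m : ℕ} (hab : a ≠ b) (hma : m ≠ a) : bisectDir a b m a = -1 := by
  simp [bisectDir, Pi.single_eq_of_ne hma.symm, Pi.single_eq_of_ne hab]

theorem bisectDir_right {a b m : ℕ} (hab : a ≠ b) (hmb : m ≠ b) : bisectDir a b m b = -1 := by
  simp [bisectDir, Pi.single_eq_of_ne hmb.symm, Pi.single_eq_of_ne hab.symm]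

theorem bisectDir_mid {a b m : ℕ} (hma : m ≠ a) (hmb : m ≠ b) : bisectDir a b m m = 2 := by
  simp [bisectDir, Pi.single_eq_of_ne hma, Pi.single_eq_of_ne hmb]

theorem bisectDir_other {a b m v : ℕ} (h1 : v ≠ a) (h2 : v ≠ b) (h3 : v ≠ m) :
    bisectDir a b m v = 0 := by
  simp [bisectDir, Pi.single_eq_of_ne h1, Pi.single_eq_of_ne h2, Pi.single_eq_of_ne h3]

/-- The piecewise linear map from a complex to its bisection. -/
noncomputable def toBisect (a b m : ℕ) (w : ℕ → ℝ) : ℕ → ℝ := w + min (w a) (w b) • bisectDir a b m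

/-- The linear map from the bisection of a complex to the complex. -/
noncomputable def ofBisect (a b m : ℕ) (w : ℕ → ℝ) : ℕ → ℝ := w - (w m / 2) • bisectDir a b m

theorem toBisect_comm (a b m : ℕ) (w : ℕ → ℝ) : toBisect a b m w = toBisect b a m w := by
  rw [toBisect, toBisect, bisectDir_comm, min_comm]

theorem continuous_toBisect (a b m : ℕ) : Continuous (toBisect a b m) := by
  unfold toBisect
  fun_prop

theorem continuous_ofBisect (a b m : ℕ) : Continuous (ofBisect a b m) := by
  unfold ofBisect
  fun_prop

/-- With `w a ≤ w b` the point lies in the half of its simplex on the side of `b`. Moving the amount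
`w a` from each of `a` and `b` onto `m` empties `a`, and the new support no longer contains the
edge. -/
theorem toBisect_mem_of_le {K : PreAbstractSimplicialComplex ℕ} {a b m : ℕ} (hab : a ≠ b)
    (hma : m ≠ a) (hmb : m ≠ b) (hm : m ∉ vertexSet K) {w : ℕ → ℝ} (hw : w ∈ realization K)
    (hle : w a ≤ w b) : toBisect a b m w ∈ realization (bisect K a b m) := by
  obtain ⟨s, hs, hws⟩ := hw
  have hms : m ∉ s := fun h => hm (mem_vertexSet hs h)
  have hwm : w m = 0 := hws.2.1 m hms
  by_cases h0 : w a = 0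
  · have : toBisect a b m w = w := by
      rw [toBisect, min_eq_left hle, h0, zero_smul, add_zero]
    rw [this]
    have h1 : w ∈ geomSimplex (s.erase a) := by
      refine mem_geomSimplex_of_subset hws (Finset.erase_subset _ _) fun v hv hva => ?_
      have : v = a := by by_contra h; exact hva (Finset.mem_erase.2 ⟨h, hv⟩)
      rw [this, h0]
    refine ⟨s.erase a, ⟨nonempty_of_mem_geomSimplex h1, ?_, ?_⟩, h1⟩
    · intro h
      have : a ∈ s.erase a := h (by simp)
      simp at this
    · rw [if_neg (fun h => hms (Finset.mem_of_mem_erase h))]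
      exact face_subset hs (Finset.erase_subset _ _) (nonempty_of_mem_geomSimplex h1)
  · have ha : 0 < w a := lt_of_le_of_ne (hws.1 a) (Ne.symm h0)
    have has : a ∈ s := by by_contra h; exact h0 (hws.2.1 a h)
    have hbs : b ∈ s := by by_contra h; have := hws.2.1 b h; linarith
    have hval : ∀ v, toBisect a b m w v = w v + w a * bisectDir a b m v := fun v => by
      simp [toBisect, min_eq_left hle]
    refine ⟨insert m (s.erase a), ⟨⟨m, by simp⟩, ?_, ?_⟩, ?_⟩
    · intro h
      have : a ∈ insert m (s.erase a) := h (by simp)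
      simp [hma.symm] at this
    · rw [if_pos (by simp)]
      refine face_subset hs ?_ ⟨a, by simp⟩
      intro v hv
      simp only [Finset.mem_union, Finset.mem_erase, Finset.mem_insert, Finset.mem_singleton] at hv
      grind
    · have hs' : toBisect a b m w ∈ geomSimplex (insert m s) := by
        refine ⟨fun v => ?_, fun v hv => ?_, ?_⟩
        · rw [hval]
          have := hws.1 v
          by_cases h1 : v = a
          · subst h1; rw [bisectDir_left hab hma]; linarith
          by_cases h2 : v = b
          · subst h2; rw [bisectDir_right hab hmb]; linarith
          by_cases h3 : v = m
          · subst h3; rw [bisectDir_mid hma hmb]; linarith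
          rw [bisectDir_other h1 h2 h3]; linarith
        · rw [Finset.mem_insert, not_or] at hv
          rw [hval, hws.2.1 v hv.2, bisectDir_other _ _ hv.1]
          · ring
          · rintro rfl; exact hv.2 has
          · rintro rfl; exact hv.2 hbs
        · simp only [hval]
          rw [Finset.sum_add_distrib, ← Finset.mul_sum, sum_bisectDir (by simp [has])
            (by simp [hbs]) (by simp), Finset.sum_insert hms, hws.2.2, hwm]
          ring
      refine mem_geomSimplex_of_subset hs' (Finset.insert_subset_insert _
        (Finset.erase_subset _ _)) fun v hv hva => ?_
      have : v = a := by
        simp only [Finset.mem_insert, Finset.mem_erase] at hv hva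
        grind
      subst this
      rw [hval, bisectDir_left hab hma]
      ring

theorem toBisect_mem {K : PreAbstractSimplicialComplex ℕ} {a b m : ℕ} (hab : a ≠ b)
    (hma : m ≠ a) (hmb : m ≠ b) (hm : m ∉ vertexSet K) {w : ℕ → ℝ} (hw : w ∈ realization K) :
    toBisect a b m w ∈ realization (bisect K a b m) := by
  rcases le_total (w a) (w b) with h | h
  · exact toBisect_mem_of_le hab hma hmb hm hw h
  · rw [bisect_comm, toBisect_comm]
    exact toBisect_mem_of_le hab.symm hmb hma hm hw h

/-- This is the linear map placing `m` at the midpoint of the edge: its weight is shared equally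
between `a` and `b`. -/
theorem ofBisect_mem {K : PreAbstractSimplicialComplex ℕ} {a b m : ℕ} (hab : a ≠ b)
    (hma : m ≠ a) (hmb : m ≠ b) {w : ℕ → ℝ}
    (hw : w ∈ realization (bisect K a b m)) : ofBisect a b m w ∈ realization K := by
  obtain ⟨t, ht, hwt⟩ := hw
  have hval : ∀ v, ofBisect a b m w v = w v - w m / 2 * bisectDir a b m v := fun v => by
    simp [ofBisect]
  by_cases hmt : m ∈ t
  · refine ⟨_, mem_bisect_of_mem ht hmt, ?_⟩
    set s := t.erase m ∪ {a, b} with hs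
    have has : a ∈ s := by simp [hs]
    have hbs : b ∈ s := by simp [hs]
    have hms : m ∉ s := by simp [hs, hma, hmb]
    have hw0 := hwt.1 m
    have hts : t ⊆ insert m s := by
      intro v hv
      by_cases h : v = m <;> simp [hs, h, hv]
    have hws := geomSimplex_mono hts hwt
    have hmem : ofBisect a b m w ∈ geomSimplex (insert m s) := by
      refine ⟨fun v => ?_, fun v hv => ?_, ?_⟩
      · rw [hval]
        have := hwt.1 v
        by_cases h1 : v = a
        · subst h1; rw [bisectDir_left hab hma]; linarith
        by_cases h2 : v = b
        · subst h2; rw [bisectDir_right hab hmb]; linarith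
        by_cases h3 : v = m
        · subst h3; rw [bisectDir_mid hma hmb]; linarith
        rw [bisectDir_other h1 h2 h3]; linarith
      · rw [hval, hws.2.1 v hv]
        rw [Finset.mem_insert, not_or] at hv
        rw [bisectDir_other _ _ hv.1]
        · ring
        · rintro rfl; exact hv.2 has
        · rintro rfl; exact hv.2 hbs
      · simp only [hval]
        rw [Finset.sum_sub_distrib, ← Finset.mul_sum, sum_bisectDir (by simp [has])
            (by simp [hbs]) (by simp), hws.2.2]
        ring
    refine mem_geomSimplex_of_subset hmem (Finset.subset_insert _ _) fun v hv hvs => ?_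
    have : v = m := by
      rw [Finset.mem_insert] at hv
      tauto
    subst this
    rw [hval, bisectDir_mid hma hmb]
    ring
  · refine ⟨t, mem_bisect_of_notMem ht hmt, ?_⟩
    have : ofBisect a b m w = w := by simp [ofBisect, hwt.2.1 m hmt]
    rwa [this]

theorem ofBisect_toBisect {a b m : ℕ} (hma : m ≠ a) (hmb : m ≠ b) {w : ℕ → ℝ} (hw : w m = 0) :
    ofBisect a b m (toBisect a b m w) = w := by
  have : toBisect a b m w m / 2 = min (w a) (w b) := by
    simp [toBisect, hw, bisectDir_mid hma hmb]
  rw [ofBisect, this, toBisect, add_sub_cancel_right]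

/-- No face of the bisection contains both ends, so one of `w a`, `w b` vanishes. Once the weight of
`m` is shared out, the smaller of the two end weights is exactly `w m / 2`, which recovers `w m`. -/
theorem toBisect_ofBisect {K : PreAbstractSimplicialComplex ℕ} {a b m : ℕ} (hab : a ≠ b)
    (hma : m ≠ a) (hmb : m ≠ b) {w : ℕ → ℝ}
    (hw : w ∈ realization (bisect K a b m)) : toBisect a b m (ofBisect a b m w) = w := by
  obtain ⟨t, ht, hwt⟩ := hw
  have : min (ofBisect a b m w a) (ofBisect a b m w b) = w m / 2 := by
    have h0 : w a = 0 ∨ w b = 0 := by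
      by_contra! h
      refine ht.2.1 fun v hv => ?_
      by_contra hvt
      have := hwt.2.1 v hvt
      simp only [Finset.mem_insert, Finset.mem_singleton] at hv
      rcases hv with rfl | rfl <;> tauto
    have h1 := hwt.1 a
    have h2 := hwt.1 b
    simp only [ofBisect, Pi.sub_apply, Pi.smul_apply, smul_eq_mul, bisectDir_left hab hma,
      bisectDir_right hab hmb]
    rcases h0 with h | h
    · rw [min_eq_left (by linarith), h]; ring
    · rw [min_eq_right (by linarith), h]; ring
  rw [toBisect, this, ofBisect, sub_add_cancel]

/-- The realization of a complex is homeomorphic to that of its bisection. -/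
noncomputable def bisectHomeomorph {K : PreAbstractSimplicialComplex ℕ} {a b m : ℕ} (hab : a ≠ b)
    (hma : m ≠ a) (hmb : m ≠ b) (hm : m ∉ vertexSet K) :
    realization (bisect K a b m) ≃ₜ realization K where
  toFun w := ⟨ofBisect a b m w, ofBisect_mem hab hma hmb w.2⟩
  invFun w := ⟨toBisect a b m w, toBisect_mem hab hma hmb hm w.2⟩
  left_inv w := Subtype.ext (toBisect_ofBisect hab hma hmb w.2)
  right_inv w := Subtype.ext (ofBisect_toBisect hma hmb (eq_zero_of_mem_realization w.2 hm))
  continuous_toFun := ((continuous_ofBisect a b m).comp continuous_subtype_val).subtype_mk _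
  continuous_invFun := ((continuous_toBisect a b m).comp continuous_subtype_val).subtype_mk _

/-- Bisecting an edge with an endpoint in the interior of a triangulated ball gives a
triangulation of the ball with the same boundary. -/
theorem IsBallTriangulation.bisect {n : ℕ} {K S : PreAbstractSimplicialComplex ℕ} {a b m : ℕ}
    (h : IsBallTriangulation n K S) (hab : a ≠ b) (hma : m ≠ a) (hmb : m ≠ b)
    (hm : m ∉ vertexSet K) (ha : a ∉ vertexSet S) : IsBallTriangulation n (bisect K a b m) S := by
  obtain ⟨hfin, hSK, e, he⟩ := h
  have hmS : m ∉ vertexSet S := fun h => hm (hSK h)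
  refine ⟨finite_bisect hfin a b m, fun s hs => ⟨face_nonempty hs, fun h => ?_, ?_⟩,
    (bisectHomeomorph hab hma hmb hm).trans e, fun x => ?_⟩
  · exact ha (mem_vertexSet hs (h (by simp)))
  · rw [if_neg (fun h => hmS (mem_vertexSet hs h))]
    exact hSK hs
  · change (e (bisectHomeomorph hab hma hmb hm x) : EuclideanSpace ℝ (Fin n)) ∈ _ ↔ _
    rw [he]
    change ofBisect a b m x ∈ _ ↔ _
    have key : (x : ℕ → ℝ) m = 0 → ofBisect a b m x = x := fun h => by simp [ofBisect, h]
    constructor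
    · intro hx
      -- The image has weight `w a + w m / 2` at the interior vertex `a`, and this must vanish on
      -- `S`. Hence `w m = 0` and the point was not moved.
      have h0 := eq_zero_of_mem_realization hx ha
      obtain ⟨t, -, ht⟩ := x.2
      have h1 := ht.1 a
      have h2 := ht.1 m
      simp only [ofBisect, Pi.sub_apply, Pi.smul_apply, smul_eq_mul,
        bisectDir_left hab hma] at h0
      rwa [key (by linarith)] at hx
    · intro hx
      rwa [key (eq_zero_of_mem_realization hx hmS)]

/-! ### Cones -/

/-- Where the factor vanishes, boundedness of `u` forces the product to tend to zero, even if `u` is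
discontinuous. This serves radial maps, whose direction is undefined at the centre. -/
theorem ContinuousOn.smul_of_bounded {T E : Type*} [TopologicalSpace T] [NormedAddCommGroup E]
    [NormedSpace ℝ E] {s : Set T} {c : T → ℝ} {u : T → E} {C : ℝ} (hc : ContinuousOn c s)
    (hu : ContinuousOn u (s ∩ {x | c x ≠ 0})) (hC : ∀ x ∈ s, ‖u x‖ ≤ C) :
    ContinuousOn (fun x => c x • u x) s := by
  intro x hx
  by_cases h0 : c x = 0
  · have h1 : Filter.Tendsto (fun y => |c y| * C) (nhdsWithin x s) (nhds (|c x| * C)) :=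
      (hc x hx).abs.mul_const C
    rw [h0, abs_zero, zero_mul] at h1
    rw [ContinuousWithinAt, h0, zero_smul]
    refine squeeze_zero_norm' ?_ h1
    filter_upwards [self_mem_nhdsWithin] with y hy
    rw [norm_smul, Real.norm_eq_abs]
    exact mul_le_mul_of_nonneg_left (hC y hy) (abs_nonneg _)
  · have h1 : ContinuousWithinAt u s x := by
      refine (hu x ⟨hx, h0⟩).mono_of_mem_nhdsWithin ?_
      exact Filter.inter_mem self_mem_nhdsWithin ((hc x hx).eventually_ne h0)
    exact (hc x hx).smul h1

/-- The cone on a complex, with apex `p`. -/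
def coneComplex (S : PreAbstractSimplicialComplex ℕ) (p : ℕ) : PreAbstractSimplicialComplex ℕ where
  faces := {t | t.Nonempty ∧ (t.erase p = ∅ ∨ t.erase p ∈ S.faces)}
  isRelLowerSet_faces := by
    rintro t ⟨h1, h2⟩
    refine ⟨h1, fun s hst hs => ⟨hs, ?_⟩⟩
    have hsub := Finset.erase_subset_erase p hst
    rcases (s.erase p).eq_empty_or_nonempty with h | h
    · exact Or.inl h
    · rcases h2 with h2 | h2
      · rw [h2, Finset.subset_empty] at hsub
        exact Or.inl hsub
      · exact Or.inr (face_subset h2 hsub h)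

theorem finite_coneComplex {S : PreAbstractSimplicialComplex ℕ} (hS : S.faces.Finite) (p : ℕ) :
    (coneComplex S p).faces.Finite := by
  refine ((hS.biUnion (t := fun s => ((insert p s).powerset : Set (Finset ℕ)))
    fun s _ => Finset.finite_toSet _).union (Set.finite_singleton {p})).subset ?_
  rintro t ⟨h1, h2 | h2⟩
  · refine Or.inr ?_
    rw [Finset.erase_eq_empty_iff] at h2
    exact h2.resolve_left h1.ne_empty
  · refine Or.inl (Set.mem_biUnion h2 ?_)
    simp

theorem le_coneComplex {S : PreAbstractSimplicialComplex ℕ} {p : ℕ} (hp : p ∉ vertexSet S) :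
    S ≤ coneComplex S p := by
  intro s hs
  refine ⟨face_nonempty hs, Or.inr ?_⟩
  rwa [Finset.erase_eq_of_notMem (fun h => hp (mem_vertexSet hs h))]

theorem insert_mem_coneComplex {S : PreAbstractSimplicialComplex ℕ} {p : ℕ}
    (hp : p ∉ vertexSet S) {s : Finset ℕ} (hs : s ∈ S.faces) :
    insert p s ∈ (coneComplex S p).faces := by
  refine ⟨⟨p, by simp⟩, Or.inr ?_⟩
  rwa [Finset.erase_insert (fun h => hp (mem_vertexSet hs h))]

theorem singleton_mem_coneComplex (S : PreAbstractSimplicialComplex ℕ) (p : ℕ) :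
    {p} ∈ (coneComplex S p).faces := ⟨⟨p, by simp⟩, Or.inl (by simp)⟩

theorem eq_single_of_apply_eq_one {t : Finset ℕ} {w : ℕ → ℝ} {p : ℕ} (hw : w ∈ geomSimplex t)
    (h : w p = 1) : w = Pi.single p 1 := by
  have hp : p ∈ t := by
    by_contra hp
    rw [hw.2.1 p hp] at h
    exact zero_ne_one h
  have hsum := hw.2.2
  rw [← Finset.add_sum_erase _ _ hp, h] at hsum
  have h0 := (Finset.sum_eq_zero_iff_of_nonneg fun v _ => hw.1 v).1
    (show ∑ v ∈ t.erase p, w v = 0 by linarith)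
  ext v
  by_cases hv : v = p
  · subst hv; simp [h]
  · rw [Pi.single_eq_of_ne hv]
    by_cases hvt : v ∈ t
    · exact h0 v (by simp [hv, hvt])
    · exact hw.2.1 v hvt

/-- The projection of a cone from its apex to its base. -/
noncomputable def coneBase (p : ℕ) (w : ℕ → ℝ) : ℕ → ℝ := (1 - w p)⁻¹ • (w - w p • Pi.single p 1)

theorem coneBase_mem {S : PreAbstractSimplicialComplex ℕ} {p : ℕ} {w : ℕ → ℝ}
    (hw : w ∈ realization (coneComplex S p)) (h : w p ≠ 1) : coneBase p w ∈ realization S := by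
  obtain ⟨t, ht, hwt⟩ := hw
  have hlt : 0 < 1 - w p := sub_pos.2 (lt_of_le_of_ne (le_one_of_mem_geomSimplex hwt p) h)
  have hval : ∀ v, v ≠ p → coneBase p w v = (1 - w p)⁻¹ * w v := fun v hv => by
    simp [coneBase, Pi.single_eq_of_ne hv]
  have hvalp : coneBase p w p = 0 := by simp [coneBase]
  have hmem : coneBase p w ∈ geomSimplex (t.erase p) := by
    refine ⟨fun v => ?_, fun v hv => ?_, ?_⟩
    · by_cases hv : v = p
      · rw [hv, hvalp]
      · rw [hval v hv]
        exact mul_nonneg (inv_nonneg.2 hlt.le) (hwt.1 v)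
    · by_cases hvp : v = p
      · rw [hvp, hvalp]
      · rw [hval v hvp, hwt.2.1 v (fun h => hv (by simp [hvp, h])), mul_zero]
    · rw [Finset.sum_congr rfl fun v hv => hval v (Finset.ne_of_mem_erase hv), ← Finset.mul_sum]
      have : ∑ v ∈ t.erase p, w v = 1 - w p := by
        by_cases hp : p ∈ t
        · have := Finset.add_sum_erase _ w hp
          rw [hwt.2.2] at this
          linarith
        · rw [Finset.erase_eq_of_notMem hp, hwt.2.2, hwt.2.1 p hp, sub_zero]
      rw [this, inv_mul_cancel₀ hlt.ne']
  rcases ht.2 with h | h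
  · rw [h] at hmem
    exact absurd (nonempty_of_mem_geomSimplex hmem) (by simp)
  · exact ⟨_, h, hmem⟩

theorem eq_add_coneBase {p : ℕ} {w : ℕ → ℝ} (h : w p ≠ 1) :
    w = (1 - w p) • coneBase p w + w p • Pi.single p 1 := by
  rw [coneBase, smul_inv_smul₀ (sub_ne_zero.2 (Ne.symm h)), sub_add_cancel]

theorem cone_point_mem {S : PreAbstractSimplicialComplex ℕ} {p : ℕ} (hp : p ∉ vertexSet S)
    {y : ℕ → ℝ} (hy : y ∈ realization S) {c : ℝ} (h0 : 0 ≤ c) (h1 : c ≤ 1) :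
    (1 - c) • y + c • Pi.single p 1 ∈ realization (coneComplex S p) := by
  obtain ⟨s, hs, hys⟩ := hy
  exact ⟨_, insert_mem_coneComplex hp hs, convex_geomSimplex _
    (geomSimplex_mono (Finset.subset_insert _ _) hys) (single_mem_geomSimplex.2 (by simp))
    (by linarith) h0 (by linarith)⟩

theorem continuousOn_coneBase (p : ℕ) : ContinuousOn (coneBase p) {w | w p ≠ 1} := by
  have h1 : ContinuousOn (fun w : ℕ → ℝ => (1 - w p)⁻¹) {w | w p ≠ 1} :=
    ContinuousOn.inv₀ (by fun_prop) fun w hw => sub_ne_zero.2 (Ne.symm hw)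
  exact h1.smul (g := fun w : ℕ → ℝ => w - w p • Pi.single p 1) (by fun_prop)

/-- The cone on a triangulated sphere is a triangulated ball. -/
theorem IsSphereTriangulation.cone {n : ℕ} {S : PreAbstractSimplicialComplex ℕ}
    (hS : IsSphereTriangulation n S) {p : ℕ} (hp : p ∉ vertexSet S) :
    IsBallTriangulation (n + 1) (coneComplex S p) S := by
  classical
  obtain ⟨hfin, ⟨e⟩⟩ := hS
  have hCfin := finite_coneComplex hfin p
  refine ⟨hCfin, le_coneComplex hp, ?_⟩
  have : CompactSpace (realization (coneComplex S p)) :=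
    isCompact_iff_compactSpace.1 (isCompact_realization hCfin)
  let u : (ℕ → ℝ) → EuclideanSpace ℝ (Fin (n + 1)) := fun w =>
    if h : w ∈ realization S then (e ⟨w, h⟩ : EuclideanSpace ℝ (Fin (n + 1))) else 0
  have hu : ∀ w (h : w ∈ realization S), u w = e ⟨w, h⟩ := fun w h => dif_pos h
  have hu1 : ∀ w ∈ realization S, ‖u w‖ = 1 := fun w h => by
    rw [hu w h]
    exact mem_sphere_zero_iff_norm.1 (e ⟨w, h⟩).2
  have hule : ∀ w, ‖u w‖ ≤ 1 := fun w => by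
    by_cases h : w ∈ realization S
    · exact (hu1 w h).le
    · simp [u, dif_neg h]
  have hucont : ContinuousOn u (realization S) := by
    rw [continuousOn_iff_continuous_domRestrict]
    have : (realization S).domRestrict u = fun w => (e w : EuclideanSpace ℝ (Fin (n + 1))) := by
      ext1 w
      exact hu w w.2
    rw [this]
    fun_prop
  -- A point over the base point `y` goes in the direction `e y` to radius `1 - w p`. At the apex
  -- the direction is a default value, multiplied by zero.
  let H : (ℕ → ℝ) → EuclideanSpace ℝ (Fin (n + 1)) := fun w => (1 - w p) • u (coneBase p w)
  have hHcont : ContinuousOn H (realization (coneComplex S p)) := by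
    refine ContinuousOn.smul_of_bounded (C := 1) (by fun_prop) ?_ fun w _ => hule _
    have hne : ∀ w : ℕ → ℝ, 1 - w p ≠ 0 → w p ≠ 1 := fun w h h' => h (by rw [h', sub_self])
    exact hucont.comp ((continuousOn_coneBase p).mono fun w hw => hne w hw.2)
      fun w hw => coneBase_mem hw.1 (hne w hw.2)
  have hle : ∀ w ∈ realization (coneComplex S p), w p ≤ 1 := fun w ⟨t, _, ht⟩ =>
    le_one_of_mem_geomSimplex ht p
  have hge : ∀ w ∈ realization (coneComplex S p), 0 ≤ w p := fun w ⟨t, _, ht⟩ => ht.1 p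
  have hnorm : ∀ w ∈ realization (coneComplex S p), ‖H w‖ = 1 - w p := by
    intro w hw
    rw [norm_smul, Real.norm_eq_abs, abs_of_nonneg (sub_nonneg.2 (hle w hw))]
    by_cases h : w p = 1
    · simp [h]
    · rw [hu1 _ (coneBase_mem hw h), mul_one]
  let f : realization (coneComplex S p) → closedBall (0 : EuclideanSpace ℝ (Fin (n + 1))) 1 :=
    fun w => ⟨H w, by
      rw [mem_closedBall_zero_iff, hnorm w w.2]
      have := hge w w.2
      linarith⟩
  have hfcont : Continuous f :=
    (continuousOn_iff_continuous_domRestrict.1 hHcont).subtype_mk _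
  have hinj : Function.Injective f := by
    rintro ⟨w, hw⟩ ⟨w', hw'⟩ h
    have hH : H w = H w' := congrArg Subtype.val h
    have hp' : w p = w' p := by
      have := hnorm w hw
      rw [hH, hnorm w' hw'] at this
      linarith
    apply Subtype.ext
    change w = w'
    by_cases h1 : w p = 1
    · obtain ⟨t, -, ht⟩ := hw
      obtain ⟨t', -, ht'⟩ := hw'
      rw [eq_single_of_apply_eq_one ht h1, eq_single_of_apply_eq_one ht' (hp' ▸ h1)]
    · have h1' : w' p ≠ 1 := hp' ▸ h1
      simp only [H, ← hp'] at hH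
      have hu' := smul_right_injective _ (sub_ne_zero.2 (Ne.symm h1)) hH
      rw [hu _ (coneBase_mem hw h1), hu _ (coneBase_mem hw' h1')] at hu'
      have := congrArg Subtype.val (e.injective (Subtype.ext hu'))
      simp only at this
      rw [eq_add_coneBase h1, eq_add_coneBase h1', this, hp']
  have hsurj : Function.Surjective f := by
    rintro ⟨z, hz⟩
    rw [mem_closedBall_zero_iff] at hz
    by_cases h0 : z = 0
    · refine ⟨⟨Pi.single p 1, _, singleton_mem_coneComplex S p,
        single_mem_geomSimplex.2 (by simp)⟩, Subtype.ext ?_⟩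
      change H _ = z
      simp [H, h0]
    · have hz0 : 0 < ‖z‖ := norm_pos_iff.2 h0
      have hzs : ‖z‖⁻¹ • z ∈ sphere (0 : EuclideanSpace ℝ (Fin (n + 1))) 1 := by
        rw [mem_sphere_zero_iff_norm, norm_smul, norm_inv, norm_norm, inv_mul_cancel₀ hz0.ne']
      set y := e.symm ⟨_, hzs⟩ with hy
      have hyp : (y : ℕ → ℝ) p = 0 := eq_zero_of_mem_realization y.2 hp
      have hmem := cone_point_mem hp y.2 (sub_nonneg.2 hz) (by linarith)
      rw [sub_sub_cancel] at hmem
      refine ⟨⟨_, hmem⟩, Subtype.ext ?_⟩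
      change H _ = z
      set w := ‖z‖ • (y : ℕ → ℝ) + (1 - ‖z‖) • Pi.single p 1 with hw
      have hwp : 1 - w p = ‖z‖ := by simp [hw, hyp]
      have hbase : coneBase p w = y := by
        have hwp' : w p = 1 - ‖z‖ := by linarith
        rw [coneBase, hwp, hwp', hw, add_sub_cancel_right, inv_smul_smul₀ hz0.ne']
      change (1 - w p) • u (coneBase p w) = z
      rw [hwp, hbase, hu y y.2, Subtype.coe_eta, hy, Homeomorph.apply_symm_apply]
      exact smul_inv_smul₀ hz0.ne' z
  refine ⟨Continuous.homeoOfEquivCompactToT2 (f := Equiv.ofBijective f ⟨hinj, hsurj⟩) hfcont, ?_⟩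
  rintro ⟨w, hw⟩
  change H w ∈ _ ↔ w ∈ _
  rw [mem_sphere_zero_iff_norm, hnorm w hw]
  constructor
  · intro h
    have hwp : w p = 0 := by linarith
    have := coneBase_mem hw (by rw [hwp]; exact zero_ne_one)
    rwa [show coneBase p w = w by simp [coneBase, hwp]] at this
  · intro h
    rw [eq_zero_of_mem_realization h hp, sub_zero]

/-! ### Fine triangulations of the ball relative to the boundary -/

/-- The squared distance of two points in the first `N` coordinates. -/
noncomputable def sqDist (N : ℕ) (x y : ℕ → ℝ) : ℝ := ∑ i ∈ Finset.range N, (x i - y i) ^ 2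

theorem sqDist_self (N : ℕ) (x : ℕ → ℝ) : sqDist N x x = 0 := by simp [sqDist]

theorem sqDist_comm (N : ℕ) (x y : ℕ → ℝ) : sqDist N x y = sqDist N y x :=
  Finset.sum_congr rfl fun _ _ => by ring

theorem sqDist_nonneg (N : ℕ) (x y : ℕ → ℝ) : 0 ≤ sqDist N x y :=
  Finset.sum_nonneg fun _ _ => sq_nonneg _

theorem continuous_sqDist (N : ℕ) :
    Continuous fun z : (ℕ → ℝ) × (ℕ → ℝ) => sqDist N z.1 z.2 := by
  unfold sqDist
  fun_prop

/-- Apollonius' identity. If `xy` is a longest side of the triangle `xyz`, the median from `z` has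
squared length at most `3 / 4` of that side's; this is the rate at which bisection shrinks edges. -/
theorem sqDist_midpoint (N : ℕ) (x y z : ℕ → ℝ) :
    sqDist N ((1 / 2 : ℝ) • x + (1 / 2 : ℝ) • y) z =
      (2 * sqDist N x z + 2 * sqDist N y z - sqDist N x y) / 4 := by
  simp only [sqDist, Finset.mul_sum, ← Finset.sum_add_distrib, ← Finset.sum_sub_distrib,
    Finset.sum_div]
  refine Finset.sum_congr rfl fun i _ => ?_
  simp only [Pi.add_apply, Pi.smul_apply, smul_eq_mul]
  ring

theorem eq_of_sqDist_eq_zero {N : ℕ} {x y : ℕ → ℝ} (hx : ∀ i, N ≤ i → x i = 0)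
    (hy : ∀ i, N ≤ i → y i = 0) (h : sqDist N x y = 0) : x = y := by
  ext i
  by_cases hi : i < N
  · have := (Finset.sum_eq_zero_iff_of_nonneg fun i _ => sq_nonneg (x i - y i)).1 h i
      (Finset.mem_range.2 hi)
    exact sub_eq_zero.1 (pow_eq_zero_iff two_ne_zero |>.1 this)
  · rw [hx i (not_lt.1 hi), hy i (not_lt.1 hi)]

theorem sqDist_le {N : ℕ} {s t : Finset ℕ} {x y : ℕ → ℝ} (hx : x ∈ geomSimplex s)
    (hy : y ∈ geomSimplex t) : sqDist N x y ≤ N := by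
  have : ∀ i ∈ Finset.range N, (x i - y i) ^ 2 ≤ 1 := fun i _ => by
    have := hx.1 i
    have := hy.1 i
    have := le_one_of_mem_geomSimplex hx i
    have := le_one_of_mem_geomSimplex hy i
    rw [sq_le_one_iff_abs_le_one, abs_le]
    constructor <;> linarith
  simpa [sqDist] using Finset.sum_le_sum this

/-- A triangulation `K` of the ball with boundary `S`, with a position `g v` in the cone on `S`
for each vertex `v` of `K`, such that the vertices of each face lie in a common simplex of the
cone, which can be chosen in `S` if the face meets the boundary. -/
structure IsPositioned (n : ℕ) (S : PreAbstractSimplicialComplex ℕ) (p : ℕ)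
    (K : PreAbstractSimplicialComplex ℕ) (g : ℕ → ℕ → ℝ) : Prop where
  ball : IsBallTriangulation n K S
  boundary : ∀ v ∈ vertexSet S, g v = Pi.single v 1
  -- Positions may coincide and are not tied to the homeomorphism of `K` with the ball; only common
  -- carriers of faces matter. The condition on faces meeting the boundary replaces a length bound
  -- there.
  carried : ∀ t ∈ K.faces, ∃ r ∈ (coneComplex S p).faces, (∀ v ∈ t, g v ∈ geomSimplex r) ∧
    ((∃ v ∈ t, v ∈ vertexSet S) → r ∈ S.faces)

/-- Each edge from the apex `p` to a vertex `b` of `U` is bisected, but the new vertex is positioned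
at `b` and not at the midpoint, so the collar collapses onto `S`. Only faces through `p` can then
fail to be carried by `S` when they meet the boundary. The last clause says that `p` is no longer
adjacent to `U`, which excludes this failure once `U` contains every vertex of `S`. -/
theorem exists_collar {n : ℕ} {S : PreAbstractSimplicialComplex ℕ} {p : ℕ}
    (hS : IsSphereTriangulation n S) (hp : p ∉ vertexSet S) (U : Finset ℕ)
    (hU : (U : Set ℕ) ⊆ vertexSet S) :
    ∃ (K : PreAbstractSimplicialComplex ℕ) (g : ℕ → ℕ → ℝ), IsBallTriangulation (n + 1) K S ∧
      (∀ v ∈ vertexSet S, g v = Pi.single v 1) ∧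
      (∀ t ∈ K.faces, ∃ r ∈ (coneComplex S p).faces, (∀ v ∈ t, g v ∈ geomSimplex r) ∧
        ((∃ v ∈ t, v ∈ vertexSet S) → p ∉ t → r ∈ S.faces)) ∧
      ∀ t ∈ K.faces, p ∈ t → ∀ u ∈ t, u ∉ U := by
  induction U using Finset.induction_on with
  | empty =>
    refine ⟨coneComplex S p, fun v => Pi.single v 1, hS.cone hp, fun _ _ => rfl, fun t ht => ?_,
      by simp⟩
    refine ⟨t, ht, fun v hv => single_mem_geomSimplex.2 hv, fun _ hpt => ?_⟩
    rcases ht.2 with h | h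
    · rw [Finset.erase_eq_of_notMem hpt] at h
      exact absurd h ht.1.ne_empty
    · rwa [Finset.erase_eq_of_notMem hpt] at h
  | insert b U hb ih =>
    rw [Finset.coe_insert, Set.insert_subset_iff] at hU
    obtain ⟨K, g, hK, hg, hcar, hadj⟩ := ih hU.2
    have hbS := hU.1
    have hpb : p ≠ b := fun h => hp (h ▸ hbS)
    obtain ⟨m, hm⟩ := ((finite_vertexSet hK.1).union (Set.finite_singleton p)).exists_notMem
    rw [Set.mem_union, Set.mem_singleton_iff, not_or] at hm
    obtain ⟨hmK, hmp⟩ := hm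
    have hmS : m ∉ vertexSet S := fun h => hmK (hK.2.1 h)
    have hmb : m ≠ b := fun h => hmS (h ▸ hbS)
    refine ⟨bisect K p b m, Function.update g m (Pi.single b 1),
      hK.bisect hpb hmp hmb hmK hp, fun v hv => ?_, fun t ht => ?_, fun t ht hpt u hut => ?_⟩
    · rw [Function.update_of_ne (ne_of_mem_of_not_mem hv hmS), hg v hv]
    · by_cases hmt : m ∈ t
      -- Since `m` sits at `b`, a carrier of the face with `m` exchanged for `b` also carries `t`.
      · have key : ∀ r, (∀ v ∈ t.erase m ∪ {b}, g v ∈ geomSimplex r) →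
            ∀ v ∈ t, Function.update g m (Pi.single b 1) v ∈ geomSimplex r := by
          intro r hr v hv
          by_cases h : v = m
          · subst h
            rw [Function.update_self, ← hg b hbS]
            exact hr b (by simp)
          · rw [Function.update_of_ne h]
            exact hr v (by simp [h, hv])
        have h1 := mem_bisect_of_mem ht hmt
        have hsub : t.erase m ∪ {b} ⊆ t.erase m ∪ {p, b} :=
          Finset.union_subset_union subset_rfl (by simp)
        by_cases hc : p ∈ t
        · obtain ⟨r, hr, hr1, -⟩ := hcar _ h1
          exact ⟨r, hr, key r fun v hv => hr1 v (hsub hv), fun _ h => absurd hc h⟩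
        -- The face `t.erase m ∪ {b}` omits the apex and contains the boundary vertex `b`, so its
        -- carrier lies in `S`.
        · obtain ⟨r, hr, hr1, hr2⟩ := hcar _ (face_subset h1 hsub ⟨b, by simp⟩)
          exact ⟨r, hr, key r hr1, fun _ _ => hr2 ⟨b, by simp, hbS⟩ (by simp [hc, hpb])⟩
      · obtain ⟨r, hr, hr1, hr2⟩ := hcar t (mem_bisect_of_notMem ht hmt)
        refine ⟨r, hr, fun v hv => ?_, hr2⟩
        rw [Function.update_of_ne (ne_of_mem_of_not_mem hv hmt)]
        exact hr1 v hv
    · rw [Finset.mem_insert, not_or]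
      refine ⟨fun h => ht.2.1 ?_, fun h => ?_⟩
      · subst h
        simp [Finset.insert_subset_iff, hpt, hut]
      · by_cases hmt : m ∈ t
        · have hum : u ≠ m := fun h' => hmS (h' ▸ hU.2 h)
          exact hadj _ (mem_bisect_of_mem ht hmt) (by simp) u (by simp [hum, hut]) h
        · exact hadj t (mem_bisect_of_notMem ht hmt) hpt u hut h

theorem exists_isPositioned {n : ℕ} {S : PreAbstractSimplicialComplex ℕ} {p : ℕ}
    (hS : IsSphereTriangulation n S) (hp : p ∉ vertexSet S) :
    ∃ (K : PreAbstractSimplicialComplex ℕ) (g : ℕ → ℕ → ℝ), IsPositioned (n + 1) S p K g := by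
  have hfin := finite_vertexSet hS.1
  obtain ⟨K, g, h1, h2, h3, h4⟩ := exists_collar hS hp hfin.toFinset (by simp)
  refine ⟨K, g, h1, h2, fun t ht => ?_⟩
  obtain ⟨r, hr, hr1, hr2⟩ := h3 t ht
  refine ⟨r, hr, hr1, fun hv => hr2 hv fun hpt => ?_⟩
  obtain ⟨v, hv, hvS⟩ := hv
  exact h4 t ht hpt v hv (by simpa using hvS)

theorem IsPositioned.bisect_edge {n : ℕ} {S : PreAbstractSimplicialComplex ℕ} {p : ℕ}
    {K : PreAbstractSimplicialComplex ℕ} {g : ℕ → ℕ → ℝ} (h : IsPositioned n S p K g)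
    {a b m : ℕ} (hab : a ≠ b) (hma : m ≠ a) (hmb : m ≠ b) (hm : m ∉ vertexSet K)
    (ha : a ∉ vertexSet S) :
    IsPositioned n S p (bisect K a b m)
      (Function.update g m ((1 / 2 : ℝ) • g a + (1 / 2 : ℝ) • g b)) := by
  have hmS : m ∉ vertexSet S := fun h' => hm (h.ball.2.1 h')
  refine ⟨h.ball.bisect hab hma hmb hm ha, fun v hv => ?_, fun t ht => ?_⟩
  · rw [Function.update_of_ne (ne_of_mem_of_not_mem hv hmS), h.boundary v hv]
  · by_cases hmt : m ∈ t
    · obtain ⟨r, hr, hr1, hr2⟩ := h.carried _ (mem_bisect_of_mem ht hmt)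
      refine ⟨r, hr, fun v hv => ?_, fun ⟨v, hv, hvS⟩ => hr2 ⟨v, ?_, hvS⟩⟩
      · by_cases hvm : v = m
        · subst hvm
          rw [Function.update_self]
          exact convex_geomSimplex r (hr1 a (by simp)) (hr1 b (by simp)) (by norm_num)
            (by norm_num) (by norm_num)
        · rw [Function.update_of_ne hvm]
          exact hr1 v (by simp [hvm, hv])
      · have hvm : v ≠ m := fun h' => hmS (h' ▸ hvS)
        simp [hvm, hv]
    · obtain ⟨r, hr, hr1, hr2⟩ := h.carried t (mem_bisect_of_notMem ht hmt)
      refine ⟨r, hr, fun v hv => ?_, hr2⟩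
      rw [Function.update_of_ne (ne_of_mem_of_not_mem hv hmt)]
      exact hr1 v hv

/-- The pairs of interior vertices of `K` that span an edge (or coincide). -/
def interiorEdges (S K : PreAbstractSimplicialComplex ℕ) : Set (ℕ × ℕ) :=
  {e | {e.1, e.2} ∈ K.faces ∧ e.1 ∉ vertexSet S ∧ e.2 ∉ vertexSet S}

theorem finite_interiorEdges {S K : PreAbstractSimplicialComplex ℕ} (hK : K.faces.Finite) :
    (interiorEdges S K).Finite :=
  ((finite_vertexSet hK).prod (finite_vertexSet hK)).subset fun e he =>
    ⟨mem_vertexSet he.1 (by simp), mem_vertexSet he.1 (by simp)⟩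

/-- Induction on the number of interior edges of squared length above `3 / 4 * L`. Bisecting a
longest interior edge destroys it, and by `sqDist_midpoint` the new interior edges are not among the
long ones, so the count drops. Choosing a longest edge is essential for the bound on the new edges.
-/
theorem IsPositioned.exists_refine {n : ℕ} {S : PreAbstractSimplicialComplex ℕ} {p N : ℕ}
    {L : ℝ} (hL : 0 ≤ L) (k : ℕ) :
    ∀ (K : PreAbstractSimplicialComplex ℕ) (g : ℕ → ℕ → ℝ), IsPositioned n S p K g →
      (∀ e ∈ interiorEdges S K, sqDist N (g e.1) (g e.2) ≤ L) →
      (interiorEdges S K ∩ {e | 3 / 4 * L < sqDist N (g e.1) (g e.2)}).ncard ≤ k →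
      ∃ (K' : PreAbstractSimplicialComplex ℕ) (g' : ℕ → ℕ → ℝ), IsPositioned n S p K' g' ∧
        ∀ e ∈ interiorEdges S K', sqDist N (g' e.1) (g' e.2) ≤ 3 / 4 * L := by
  induction k with
  | zero =>
    intro K g hKg _ hk
    refine ⟨K, g, hKg, fun e he => ?_⟩
    have hfin := (finite_interiorEdges (S := S) hKg.ball.1).inter_of_left
      {e | 3 / 4 * L < sqDist N (g e.1) (g e.2)}
    have := (Set.ncard_eq_zero hfin).1 (Nat.le_zero.1 hk)
    by_contra hlt
    have : e ∈ (∅ : Set (ℕ × ℕ)) := this ▸ ⟨he, not_le.1 hlt⟩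
    exact this
  | succ k ih =>
    intro K g hKg hKL hk
    have hEfin := finite_interiorEdges (S := S) hKg.ball.1
    by_cases hex : ∃ e ∈ interiorEdges S K, 3 / 4 * L < sqDist N (g e.1) (g e.2)
    swap
    · push Not at hex
      exact ⟨K, g, hKg, hex⟩
    obtain ⟨e₀, he₀, he₀L⟩ := hex
    obtain ⟨⟨a, b⟩, he, hmax⟩ := Set.exists_max_image _
      (fun e : ℕ × ℕ => sqDist N (g e.1) (g e.2)) hEfin ⟨e₀, he₀⟩
    have hlong : 3 / 4 * L < sqDist N (g a) (g b) := he₀L.trans_le (hmax e₀ he₀)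
    have hle := hKL _ he
    obtain ⟨hface, haS, hbS⟩ := he
    simp only at hface haS hbS hle hmax
    have hab : a ≠ b := by
      rintro rfl
      rw [sqDist_self] at hlong
      linarith
    obtain ⟨m, hm⟩ := exists_fresh hKg.ball.1
    have hma : m ≠ a := fun h => hm (h ▸ mem_vertexSet hface (by simp))
    have hmb : m ≠ b := fun h => hm (h ▸ mem_vertexSet hface (by simp))
    set g' := Function.update g m ((1 / 2 : ℝ) • g a + (1 / 2 : ℝ) • g b) with hg'
    have hg'm : g' m = (1 / 2 : ℝ) • g a + (1 / 2 : ℝ) • g b := Function.update_self ..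
    have hg'ne : ∀ v, v ≠ m → g' v = g v := fun v hv => Function.update_of_ne hv ..
    have hnew : ∀ w, w ≠ m → w ∉ vertexSet S → {m, w} ∈ (bisect K a b m).faces →
        sqDist N (g' m) (g' w) ≤ 3 / 4 * L := by
      intro w hwm hwS hw
      have h1 := mem_bisect_of_mem hw (by simp)
      have haw : {a, w} ∈ K.faces := face_subset h1 (by grind) (by simp)
      have hbw : {b, w} ∈ K.faces := face_subset h1 (by grind) (by simp)
      rw [hg'm, hg'ne w hwm, sqDist_midpoint]
      have := hmax (a, w) ⟨haw, haS, hwS⟩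
      have := hmax (b, w) ⟨hbw, hbS, hwS⟩
      simp only at *
      linarith
    have hcases : ∀ e ∈ interiorEdges S (bisect K a b m),
        sqDist N (g' e.1) (g' e.2) ≤ 3 / 4 * L ∨
          (e ∈ interiorEdges S K ∧ e ≠ (a, b) ∧
            sqDist N (g' e.1) (g' e.2) = sqDist N (g e.1) (g e.2)) := by
      rintro ⟨u, w⟩ ⟨h1, h2, h3⟩
      simp only at h1 h2 h3 ⊢
      by_cases hu : u = m
      · left
        by_cases hw : w = m
        · rw [hu, hw, sqDist_self]
          positivity
        · rw [hu] at h1 ⊢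
          exact hnew w hw h3 h1
      · by_cases hw : w = m
        · left
          rw [hw] at h1 ⊢
          rw [Finset.pair_comm] at h1
          rw [sqDist_comm]
          exact hnew u hu h2 h1
        · right
          refine ⟨⟨mem_bisect_of_notMem h1 (by simp [Ne.symm hu, Ne.symm hw]), h2, h3⟩, ?_, ?_⟩
          · intro h
            rw [Prod.mk.injEq] at h
            apply h1.2.1
            rw [h.1, h.2]
          · rw [hg'ne u hu, hg'ne w hw]
    refine ih (bisect K a b m) g' (hKg.bisect_edge hab hma hmb hm haS) (fun e he => ?_) ?_
    · rcases hcases e he with h | ⟨h1, -, h3⟩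
      · linarith
      · rw [h3]; exact hKL e h1
    · have hmem : (a, b) ∈ interiorEdges S K ∩ {e | 3 / 4 * L < sqDist N (g e.1) (g e.2)} :=
        ⟨⟨hface, haS, hbS⟩, hlong⟩
      have hlt := Set.ncard_sdiff_singleton_lt_of_mem hmem (hEfin.inter_of_left _)
      refine (Set.ncard_le_ncard ?_ ((hEfin.inter_of_left _).sdiff)).trans
        (Nat.lt_succ_iff.1 (hlt.trans_le hk))
      rintro e ⟨he, heL⟩
      rcases hcases e he with h | ⟨h1, h2, h3⟩
      · exact absurd heL (not_lt.2 h)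
      · exact ⟨⟨h1, by rw [Set.mem_ofPred_eq, ← h3]; exact heL⟩, h2⟩

/-- There are arbitrarily fine positioned triangulations of the ball with given boundary. -/
theorem exists_fine_isPositioned {n : ℕ} {S : PreAbstractSimplicialComplex ℕ} {p : ℕ}
    (hS : IsSphereTriangulation n S) (hp : p ∉ vertexSet S) (N : ℕ) {ε : ℝ} (hε : 0 < ε) :
    ∃ (K : PreAbstractSimplicialComplex ℕ) (g : ℕ → ℕ → ℝ), IsPositioned (n + 1) S p K g ∧
      ∀ u v, u ∉ vertexSet S → v ∉ vertexSet S → {u, v} ∈ K.faces →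
        sqDist N (g u) (g v) ≤ ε := by
  -- Weights lie in `[0, 1]`, so squared distances start at most `N`; every round of refinement
  -- gains a factor `3 / 4`.
  have key : ∀ k : ℕ, ∃ (K : PreAbstractSimplicialComplex ℕ) (g : ℕ → ℕ → ℝ),
      IsPositioned (n + 1) S p K g ∧
        ∀ e ∈ interiorEdges S K, sqDist N (g e.1) (g e.2) ≤ (3 / 4) ^ k * (N : ℝ) := by
    intro k
    induction k with
    | zero =>
      obtain ⟨K, g, h⟩ := exists_isPositioned hS hp
      refine ⟨K, g, h, fun e he => ?_⟩
      obtain ⟨r, -, hr, -⟩ := h.carried _ he.1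
      rw [pow_zero, one_mul]
      exact sqDist_le (hr e.1 (by simp)) (hr e.2 (by simp))
    | succ k ih =>
      obtain ⟨K, g, h, hL⟩ := ih
      rw [pow_succ', mul_assoc]
      exact IsPositioned.exists_refine (by positivity) _ K g h hL le_rfl
  obtain ⟨k, hk⟩ := exists_pow_lt_of_lt_one (show 0 < ε / (N + 1) by positivity)
    (show (3 / 4 : ℝ) < 1 by norm_num)
  obtain ⟨K, g, h, hL⟩ := key k
  refine ⟨K, g, h, fun u v hu hv huv => (hL (u, v) ⟨huv, hu, hv⟩).trans ?_⟩
  rw [lt_div_iff₀ (by positivity)] at hk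
  have : (0 : ℝ) ≤ (3 / 4) ^ k := by positivity
  nlinarith

/-! ### Extending maps over a simplex -/

/-- The boundary of a geometric simplex. -/
def simplexBoundary (s : Finset ℕ) : Set (ℕ → ℝ) := {w ∈ geomSimplex s | ∃ v ∈ s, w v = 0}

/-- The coordinates on a `(k + 1)`-simplex obtained by subtracting the last barycentric
coordinate. -/
noncomputable def simplexCoord {k : ℕ} (o : Fin (k + 2) → ℕ) (w : ℕ → ℝ) :
    EuclideanSpace ℝ (Fin (k + 1)) :=
  WithLp.toLp 2 fun i => w (o i.castSucc) - w (o (Fin.last _))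

/-- The weights on the vertices of a `(k + 1)`-simplex with given differences from the last
weight, which is zero. -/
noncomputable def simplexWeight {k : ℕ} (o : Fin (k + 2) → ℕ)
    (z : EuclideanSpace ℝ (Fin (k + 1))) : ℕ → ℝ :=
  ∑ i : Fin (k + 1), z i • Pi.single (o i.castSucc) 1

theorem continuous_simplexCoord {k : ℕ} (o : Fin (k + 2) → ℕ) : Continuous (simplexCoord o) := by
  unfold simplexCoord
  fun_prop

theorem continuous_simplexWeight {k : ℕ} (o : Fin (k + 2) → ℕ) :
    Continuous (simplexWeight o) := by
  unfold simplexWeight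
  fun_prop

theorem simplexWeight_last {k : ℕ} {o : Fin (k + 2) → ℕ} (ho : Function.Injective o)
    (z : EuclideanSpace ℝ (Fin (k + 1))) : simplexWeight o z (o (Fin.last _)) = 0 := by
  rw [simplexWeight, Finset.sum_apply]
  refine Finset.sum_eq_zero fun i _ => ?_
  rw [Pi.smul_apply, Pi.single_eq_of_ne, smul_zero]
  exact fun h => Fin.castSucc_ne_last i (ho h).symm

theorem simplexWeight_castSucc {k : ℕ} {o : Fin (k + 2) → ℕ} (ho : Function.Injective o)
    (z : EuclideanSpace ℝ (Fin (k + 1))) (i : Fin (k + 1)) :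
    simplexWeight o z (o i.castSucc) = z i := by
  rw [simplexWeight, Finset.sum_apply, Finset.sum_eq_single i]
  · simp
  · intro j _ hj
    rw [Pi.smul_apply, Pi.single_eq_of_ne, smul_zero]
    exact fun h => hj (Fin.castSucc_injective _ (ho h)).symm
  · simp

theorem simplexWeight_smul_simplexCoord {k : ℕ} {o : Fin (k + 2) → ℕ}
    (ho : Function.Injective o) (c : ℝ) (w : ℕ → ℝ) (j : Fin (k + 2)) :
    simplexWeight o (c • simplexCoord o w) (o j) = c * (w (o j) - w (o (Fin.last _))) := by
  induction j using Fin.lastCases with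
  | last => rw [simplexWeight_last ho, sub_self, mul_zero]
  | cast i =>
    rw [simplexWeight_castSucc ho]
    simp [simplexCoord]

/-- A continuous map from the boundary of a simplex of dimension at least three to an aspherical
subset extends over the simplex. -/
theorem IsAspherical.exists_extension {X : Type*} [TopologicalSpace X] {Z : Set X}
    (hZ : IsAspherical Z) {s : Finset ℕ} (hs : 4 ≤ s.card) {b : (ℕ → ℝ) → X}
    (hb : ContinuousOn b (simplexBoundary s)) (hbZ : Set.MapsTo b (simplexBoundary s) Z) :
    ∃ ψ : (ℕ → ℝ) → X, ContinuousOn ψ (geomSimplex s) ∧ Set.MapsTo ψ (geomSimplex s) Z ∧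
      Set.EqOn ψ b (simplexBoundary s) := by
  obtain ⟨k, hk⟩ : ∃ k, s.card = k + 2 := ⟨s.card - 2, by omega⟩
  have hk2 : 2 ≤ k := by omega
  have hne : s.Nonempty := Finset.card_pos.1 (by omega)
  obtain ⟨o, ho_def⟩ : ∃ o : Fin (k + 2) → ℕ, o = fun j => s.orderEmbOfFin hk j := ⟨_, rfl⟩
  have ho : Function.Injective o := ho_def ▸ (s.orderEmbOfFin hk).injective
  have hos : ∀ j, o j ∈ s := fun j => ho_def ▸ s.orderEmbOfFin_mem hk j
  have hso : ∀ v ∈ s, ∃ j, o j = v := fun v hv => by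
    have : v ∈ Set.range (s.orderEmbOfFin hk) := by rw [Finset.range_orderEmbOfFin]; exact hv
    rw [ho_def]
    exact this
  have hcoord : ∀ w, simplexCoord o w = 0 → ∀ v ∈ s, w v = w (o (Fin.last _)) := by
    intro w hw v hv
    obtain ⟨j, rfl⟩ := hso v hv
    have := simplexWeight_smul_simplexCoord ho 1 w j
    rw [hw, smul_zero, one_mul] at this
    simp [simplexWeight] at this
    linarith
  -- The least weight is zero on the boundary and equals `1 / (k + 2)` at the barycentre, the only
  -- point of the simplex where all coordinates `simplexCoord` vanish.
  let μ : (ℕ → ℝ) → ℝ := fun w => s.inf' hne w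
  have hμ : Continuous μ := Continuous.finset_inf'_apply hne fun v _ => continuous_apply v
  have hμle : ∀ w, ∀ v ∈ s, μ w ≤ w v := fun w v hv => Finset.inf'_le w hv
  have hμex : ∀ w, ∃ v ∈ s, μ w = w v := fun w => Finset.exists_mem_eq_inf' hne w
  have hμ0 : ∀ w ∈ simplexBoundary s, μ w = 0 := by
    rintro w ⟨hw, v, hv, hv0⟩
    obtain ⟨v', -, hv'⟩ := hμex w
    exact le_antisymm (hv0 ▸ hμle w v hv) (hv' ▸ hw.1 v')
  have hconst : ∀ w ∈ geomSimplex s, simplexCoord o w = 0 → (k + 2) * μ w = 1 := by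
    intro w hw h0
    obtain ⟨v', hv's, hv'⟩ := hμex w
    have : ∀ v ∈ s, w v = μ w := fun v hv => by
      rw [hcoord w h0 v hv, hv', hcoord w h0 v' hv's]
    have h1 := hw.2.2
    rw [Finset.sum_congr rfl this, Finset.sum_const, hk, nsmul_eq_mul] at h1
    push_cast at h1
    linarith
  have hcoord_ne : ∀ w ∈ simplexBoundary s, simplexCoord o w ≠ 0 := by
    intro w hw h0
    have := hconst w hw.1 h0
    rw [hμ0 w hw, mul_zero] at this
    exact zero_ne_one this
  -- The radius in the ball: one on the boundary, zero at the barycentre. The truncation makes the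
  -- bounds hold for all `w`.
  let t : (ℕ → ℝ) → ℝ := fun w => max 0 (min 1 (1 - (k + 2) * μ w))
  have ht : Continuous t := by fun_prop
  have ht0 : ∀ w, 0 ≤ t w := fun w => le_max_left _ _
  have ht1 : ∀ w, t w ≤ 1 := fun w => max_le zero_le_one (min_le_left _ _)
  let P : (ℕ → ℝ) → EuclideanSpace ℝ (Fin (k + 1)) := fun w =>
    t w • (‖simplexCoord o w‖⁻¹ • simplexCoord o w)
  have hunit : ∀ w, ‖‖simplexCoord o w‖⁻¹ • simplexCoord o w‖ ≤ 1 := fun w => by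
    rw [norm_smul, norm_inv, norm_norm]
    exact inv_mul_le_one
  have hP1 : ∀ w, P w ∈ closedBall (0 : EuclideanSpace ℝ (Fin (k + 1))) 1 := fun w => by
    rw [mem_closedBall_zero_iff, norm_smul, Real.norm_eq_abs, abs_of_nonneg (ht0 w)]
    exact mul_le_one₀ (ht1 w) (norm_nonneg _) (hunit w)
  have hPcont : ContinuousOn P (geomSimplex s) := by
    refine ContinuousOn.smul_of_bounded (C := 1) ht.continuousOn ?_ fun w _ => hunit w
    refine ContinuousOn.fun_smul ?_ (continuous_simplexCoord o).continuousOn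
    refine ContinuousOn.inv₀ (continuous_simplexCoord o).norm.continuousOn ?_
    rintro w ⟨hw, hw0⟩ h0
    rw [norm_eq_zero] at h0
    apply hw0
    simp [t, hconst w hw h0]
  let ν : EuclideanSpace ℝ (Fin (k + 1)) → ℝ := fun z => μ (simplexWeight o z)
  have hν : Continuous ν := hμ.comp (continuous_simplexWeight o)
  let T : EuclideanSpace ℝ (Fin (k + 1)) → ℝ := fun z => ∑ v ∈ s, (simplexWeight o z v - ν z)
  have hTc : Continuous T := by
    refine continuous_finsetSum _ fun v _ => ?_
    exact ((continuous_apply v).comp (continuous_simplexWeight o)).sub hν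
  have hTpos : ∀ z ∈ sphere (0 : EuclideanSpace ℝ (Fin (k + 1))) 1, 0 < T z := by
    intro z hz
    have hnn : ∀ v ∈ s, 0 ≤ simplexWeight o z v - ν z := fun v hv => sub_nonneg.2 (hμle _ v hv)
    refine lt_of_le_of_ne (Finset.sum_nonneg hnn) fun h0 => ?_
    have h1 := (Finset.sum_eq_zero_iff_of_nonneg hnn).1 h0.symm
    have hν0 : ν z = 0 := by
      have := h1 _ (hos (Fin.last _))
      rw [simplexWeight_last ho] at this
      linarith
    have hz0 : z = 0 := by
      ext i
      have := h1 _ (hos i.castSucc)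
      rw [simplexWeight_castSucc ho, hν0, sub_zero] at this
      exact this
    rw [hz0] at hz
    simp at hz
  -- Weights with the differences prescribed by `z`, lowered until the least is zero and rescaled to
  -- total one. On the boundary this inverts the normalized coordinate map, the only inverse the
  -- argument needs.
  let back : EuclideanSpace ℝ (Fin (k + 1)) → ℕ → ℝ := fun z v =>
    if v ∈ s then (simplexWeight o z v - ν z) / T z else 0
  have hbackc : ContinuousOn back (sphere 0 1) := by
    refine continuousOn_pi.2 fun v => ?_
    by_cases hv : v ∈ s
    · simp only [back, if_pos hv]
      refine ContinuousOn.div ?_ hTc.continuousOn fun z hz => (hTpos z hz).ne'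
      exact (((continuous_apply v).comp (continuous_simplexWeight o)).sub hν).continuousOn
    · simp only [back, if_neg hv]
      exact continuousOn_const
  have hback : Set.MapsTo back (sphere 0 1) (simplexBoundary s) := by
    intro z hz
    refine ⟨⟨fun v => ?_, fun v hv => if_neg hv, ?_⟩, ?_⟩
    · simp only [back]
      split_ifs with hv
      · exact div_nonneg (sub_nonneg.2 (hμle _ v hv)) (hTpos z hz).le
      · exact le_rfl
    · rw [Finset.sum_congr rfl fun v hv => if_pos hv, ← Finset.sum_div]
      exact div_self (hTpos z hz).ne'
    · obtain ⟨v, hv, hv'⟩ := hμex (simplexWeight o z)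
      refine ⟨v, hv, ?_⟩
      simp only [back, if_pos hv]
      rw [← hv']
      simp [ν]
  have hback_coord : ∀ w ∈ simplexBoundary s,
      back (‖simplexCoord o w‖⁻¹ • simplexCoord o w) = w := by
    intro w hw
    set c := ‖simplexCoord o w‖⁻¹ with hc
    have hc0 : 0 < c := inv_pos.2 (norm_pos_iff.2 (hcoord_ne w hw))
    have hval : ∀ v ∈ s, simplexWeight o (c • simplexCoord o w) v =
        c * (w v - w (o (Fin.last _))) := fun v hv => by
      obtain ⟨j, rfl⟩ := hso v hv
      exact simplexWeight_smul_simplexCoord ho c w j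
    have hνw : ν (c • simplexCoord o w) = - (c * w (o (Fin.last _))) := by
      obtain ⟨hw', v, hv, hv0⟩ := hw
      apply le_antisymm
      · have := hμle (simplexWeight o (c • simplexCoord o w)) v hv
        rw [hval v hv, hv0] at this
        simp only [ν]
        linarith
      · refine Finset.le_inf' _ _ fun u hu => ?_
        rw [hval u hu]
        have := mul_nonneg hc0.le (hw'.1 u)
        linarith
    have hdiff : ∀ v ∈ s, simplexWeight o (c • simplexCoord o w) v -
        ν (c • simplexCoord o w) = c * w v := fun v hv => by
      rw [hval v hv, hνw]; ring
    have hTw : T (c • simplexCoord o w) = c := by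
      simp only [T]
      rw [Finset.sum_congr rfl hdiff, ← Finset.mul_sum, hw.1.2.2, mul_one]
    ext v
    by_cases hv : v ∈ s
    · simp only [back, if_pos hv]
      rw [hdiff v hv, hTw, mul_div_cancel_left₀ _ hc0.ne']
    · simp only [back, if_neg hv]
      exact (hw.1.2.1 v hv).symm
  let g : C(sphere (0 : EuclideanSpace ℝ (Fin (k + 1))) 1, Z) :=
    ⟨fun z => ⟨b (back z), hbZ (hback z.2)⟩, by
      refine Continuous.subtype_mk ?_ _
      exact continuousOn_iff_continuous_domRestrict.1 (hb.comp hbackc hback)⟩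
  obtain ⟨G, hG⟩ := hZ k hk2 g
  refine ⟨fun w => G ⟨P w, hP1 w⟩, ?_, fun w _ => (G _).2, fun w hw => ?_⟩
  · rw [continuousOn_iff_continuous_domRestrict] at hPcont ⊢
    exact continuous_subtype_val.comp (G.continuous.comp (hPcont.subtype_mk _))
  · have htw : t w = 1 := by simp [t, hμ0 w hw]
    have hPw : P w = ‖simplexCoord o w‖⁻¹ • simplexCoord o w := by simp only [P, htw, one_smul]
    have hmem : P w ∈ sphere (0 : EuclideanSpace ℝ (Fin (k + 1))) 1 := by
      rw [hPw, mem_sphere_zero_iff_norm, norm_smul, norm_inv, norm_norm,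
        inv_mul_cancel₀ (norm_ne_zero_iff.2 (hcoord_ne w hw))]
    simp only
    rw [hG _ ⟨P w, hmem⟩ rfl]
    change b (back (P w)) = b w
    rw [hPw, hback_coord w hw]

/-! ### Filling triangles and extending maps from the vertices of a complex -/

/-- A choice of paths joining (approximations of) the points of `X`, such that the triangles formed
by the paths between points at distance at most `r` can be filled, all within distance `C`. -/
structure Fillings (X : Type*) [MetricSpace X] (r C : ℝ) where
  /-- The approximating point. -/
  pt : X → X
  /-- The path joining two approximating points. -/
  path : X → X → ℝ → X
  continuous_path : ∀ x y, Continuous (path x y)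
  path_zero : ∀ x y, path x y 0 = pt x
  path_one : ∀ x y, path x y 1 = pt y
  dist_path : ∀ x y, dist x y ≤ r → ∀ t ∈ Set.Icc (0 : ℝ) 1, dist (path x y t) x ≤ C
  -- The filling is a homotopy with fixed ends from the concatenated path through `y` to the direct
  -- one: a square with two opposite sides collapsed.
  fill : ∀ x y z, dist x y ≤ r → dist y z ≤ r → dist x z ≤ r → ∃ H : ℝ × ℝ → X, Continuous H ∧
    (∀ s ∈ Set.Icc (0 : ℝ) 1, ∀ t ∈ Set.Icc (0 : ℝ) 1, dist (H (s, t)) x ≤ C) ∧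
    (∀ s ∈ Set.Icc (0 : ℝ) 1, H (s, 0) = pt x) ∧ (∀ s ∈ Set.Icc (0 : ℝ) 1, H (s, 1) = pt z) ∧
    (∀ t ∈ Set.Icc (0 : ℝ) (1 / 2), H (0, t) = path x y (2 * t)) ∧
    (∀ t ∈ Set.Icc (1 / 2 : ℝ) 1, H (0, t) = path y z (2 * t - 1)) ∧
    ∀ t ∈ Set.Icc (0 : ℝ) 1, H (1, t) = path x z t

/-- Although `σ` may jump at `w`, `H` is constant on the whole segment at height `τ w`. By
compactness of `[0, 1]`, nearby segments are mapped close to that constant. -/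
theorem continuousWithinAt_of_collapse {T X : Type*} [TopologicalSpace T] [TopologicalSpace X]
    {H : ℝ × ℝ → X} (hH : Continuous H) {A : Set T} {σ τ : T → ℝ} (hσ : ∀ w ∈ A, σ w ∈ Set.Icc 0 1)
    {w : T} (hτ : ContinuousWithinAt τ A w) {x : X}
    (hx : ∀ s ∈ Set.Icc (0 : ℝ) 1, H (s, τ w) = x) (hw : w ∈ A) :
    ContinuousWithinAt (fun w => H (σ w, τ w)) A w := by
  intro U hU
  simp only at hU
  rw [hx _ (hσ w hw)] at hU
  have h1 : ∀ᶠ t in nhds (τ w), ∀ s ∈ Set.Icc (0 : ℝ) 1, H (s, t) ∈ U := by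
    refine isCompact_Icc.eventually_forall_of_forall_eventually fun s hs => ?_
    have : Filter.Tendsto (fun z : ℝ × ℝ => H (z.2, z.1)) (nhds (τ w, s)) (nhds x) := by
      rw [← hx s hs]
      exact (hH.comp continuous_swap).tendsto (τ w, s)
    exact this hU
  change ∀ᶠ w' in nhdsWithin w A, H (σ w', τ w') ∈ U
  filter_upwards [hτ h1, self_mem_nhdsWithin] with w' h2 h3
  exact h2 _ (hσ w' h3)

/-- The triangle is viewed as a bigon with ends `a` and `c`. The height `τ` puts `b` halfway; at a
given height `w b` ranges up to `2 * min τ (1 - τ)`, and `σ` measures how far it falls short of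
this. Thus `σ = 0` is the route through `b` and `σ = 1` the edge `ac`. At the ends `σ` is not
continuous, but there the filling collapses. -/
theorem Fillings.exists_triangle {X : Type*} [MetricSpace X] {r C : ℝ} (Φ : Fillings X r C)
    {x y z : X} (hxy : dist x y ≤ r) (hyz : dist y z ≤ r) (hxz : dist x z ≤ r) {a b c : ℕ}
    (hab : a ≠ b) (hbc : b ≠ c) (hac : a ≠ c) :
    ∃ ψ : (ℕ → ℝ) → X, ContinuousOn ψ (geomSimplex {a, b, c}) ∧
      (∀ w ∈ geomSimplex {a, b, c}, dist (ψ w) x ≤ C) ∧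
      (∀ w ∈ geomSimplex {a, b, c}, w c = 0 → ψ w = Φ.path x y (w b)) ∧
      (∀ w ∈ geomSimplex {a, b, c}, w a = 0 → ψ w = Φ.path y z (w c)) ∧
      (∀ w ∈ geomSimplex {a, b, c}, w b = 0 → ψ w = Φ.path x z (w c)) := by
  obtain ⟨H, hH, hHC, h0, h1, hl, hr, ht⟩ := Φ.fill x y z hxy hyz hxz
  let τ : (ℕ → ℝ) → ℝ := fun w => w b / 2 + w c
  let σ : (ℕ → ℝ) → ℝ := fun w => 1 - w b / (2 * min (τ w) (1 - τ w))
  have hτc : Continuous τ := by fun_prop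
  have hsum : ∀ w ∈ geomSimplex {a, b, c}, w a + w b + w c = 1 := fun w hw => by
    have := hw.2.2
    rw [Finset.sum_insert (by simp [hab, hac]), Finset.sum_pair hbc] at this
    linarith
  have hτ : ∀ w ∈ geomSimplex {a, b, c}, τ w ∈ Set.Icc (0 : ℝ) 1 := fun w hw => by
    have := hsum w hw
    have := hw.1 a
    have := hw.1 b
    have := hw.1 c
    constructor <;> simp only [τ] <;> linarith
  have hσ : ∀ w ∈ geomSimplex {a, b, c}, σ w ∈ Set.Icc (0 : ℝ) 1 := fun w hw => by
    have := hsum w hw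
    have ha := hw.1 a
    have hb := hw.1 b
    have hc := hw.1 c
    have hle : w b ≤ 2 * min (τ w) (1 - τ w) := by
      have : w b / 2 ≤ min (τ w) (1 - τ w) := le_min (by simp only [τ]; linarith)
        (by simp only [τ]; linarith)
      linarith
    have h3 := div_le_one_of_le₀ hle (hb.trans hle)
    have h4 := div_nonneg hb (hb.trans hle)
    constructor <;> simp only [σ] <;> linarith
  refine ⟨fun w => H (σ w, τ w), fun w hw => ?_, fun w hw => hHC _ (hσ w hw) _ (hτ w hw),
    fun w hw hc => ?_, fun w hw ha => ?_, fun w hw hb => ?_⟩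
  · rcases eq_or_lt_of_le (hτ w hw).1 with h | h
    · exact continuousWithinAt_of_collapse hH hσ hτc.continuousWithinAt
        (fun s hs => by rw [← h]; exact h0 s hs) hw
    rcases eq_or_lt_of_le (hτ w hw).2 with h' | h'
    · exact continuousWithinAt_of_collapse hH hσ hτc.continuousWithinAt
        (fun s hs => by rw [h']; exact h1 s hs) hw
    have hpos : 2 * min (τ w) (1 - τ w) ≠ 0 :=
      (mul_pos two_pos (lt_min h (sub_pos.2 h'))).ne'
    have hσc : ContinuousAt σ w := by
      refine continuousAt_const.sub (ContinuousAt.div (continuous_apply b).continuousAt ?_ hpos)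
      fun_prop
    exact (ContinuousAt.comp (f := fun w => (σ w, τ w)) (x := w) hH.continuousAt
      (hσc.prodMk hτc.continuousAt)).continuousWithinAt
  · have hb1 := le_one_of_mem_geomSimplex hw b
    have hτw : τ w = w b / 2 := by simp only [τ, hc, add_zero]
    have hmin : 2 * min (τ w) (1 - τ w) = w b := by
      rw [hτw, min_eq_left (by linarith)]; ring
    simp only
    by_cases hb0 : w b = 0
    · rw [hb0] at hτw ⊢
      rw [hτw, zero_div, h0 _ (hσ w hw), Φ.path_zero]
    · have : σ w = 0 := by simp only [σ, hmin, div_self hb0, sub_self]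
      have hb := hw.1 b
      rw [this, hτw, hl _ ⟨by linarith, by linarith⟩]
      congr 1
      ring
  · have hsw := hsum w hw
    have hb1 := le_one_of_mem_geomSimplex hw b
    have hwc : w c = 1 - w b := by linarith
    have hτw : τ w = 1 - w b / 2 := by simp only [τ, hwc]; ring
    have hmin : 2 * min (τ w) (1 - τ w) = w b := by
      rw [hτw, min_eq_right (by linarith)]; ring
    simp only
    by_cases hb0 : w b = 0
    · rw [hwc]
      rw [hb0] at hτw ⊢
      rw [hτw, zero_div, sub_zero, h1 _ (hσ w hw), Φ.path_one]
    · have : σ w = 0 := by simp only [σ, hmin, div_self hb0, sub_self]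
      have hb := hw.1 b
      rw [this, hτw, hr _ ⟨by linarith, by linarith⟩, hwc]
      congr 1
      ring
  · have hτw : τ w = w c := by simp only [τ, hb, zero_div, zero_add]
    have : σ w = 1 := by simp only [σ, hb, zero_div, sub_zero]
    simp only
    rw [this, hτw, ht _ ⟨hw.1 c, le_one_of_mem_geomSimplex hw c⟩]

/-- A family of maps on the simplices of `S` with at most `n` vertices, compatible with passing to
faces, the simplex `s` being mapped into `Z s`. -/
def IsCompatible {X : Type*} [TopologicalSpace X] (S : PreAbstractSimplicialComplex ℕ)
    (Z : Finset ℕ → Set X) (n : ℕ) (φ : Finset ℕ → (ℕ → ℝ) → X) : Prop :=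
  ∀ s ∈ S.faces, s.card ≤ n → ContinuousOn (φ s) (geomSimplex s) ∧
    Set.MapsTo (φ s) (geomSimplex s) (Z s) ∧
    ∀ t ⊆ s, t.Nonempty → Set.EqOn (φ s) (φ t) (geomSimplex t)

/-- Distinct simplices with `n + 1` vertices are not faces of each other, so their extensions can be
chosen independently. -/
theorem IsCompatible.exists_succ {X : Type*} [TopologicalSpace X] [Nonempty X]
    {S : PreAbstractSimplicialComplex ℕ} {Z : Finset ℕ → Set X} {n : ℕ}
    {φ : Finset ℕ → (ℕ → ℝ) → X} (hφ : IsCompatible S Z n φ)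
    (hext : ∀ s ∈ S.faces, s.card = n + 1 → ∃ ψ : (ℕ → ℝ) → X, ContinuousOn ψ (geomSimplex s) ∧
      Set.MapsTo ψ (geomSimplex s) (Z s) ∧
      ∀ t ⊂ s, t.Nonempty → Set.EqOn ψ (φ t) (geomSimplex t)) :
    ∃ φ', IsCompatible S Z (n + 1) φ' := by
  classical
  choose! ψ h1 h2 h3 using hext
  refine ⟨fun s => if s.card = n + 1 then ψ s else φ s, fun s hs hcard => ?_⟩
  by_cases hc : s.card = n + 1
  · simp only [if_pos hc]
    refine ⟨h1 s hs hc, h2 s hs hc, fun t hts ht => ?_⟩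
    rcases hts.eq_or_ssubset with rfl | hss
    · rw [if_pos hc]
      exact fun _ _ => rfl
    · have : t.card ≠ n + 1 := by
        have := Finset.card_lt_card hss
        omega
      rw [if_neg this]
      exact h3 s hs hc t hss ht
  · obtain ⟨k1, k2, k3⟩ := hφ s hs (by omega)
    simp only [if_neg hc]
    refine ⟨k1, k2, fun t hts ht => ?_⟩
    have : t.card ≠ n + 1 := by
      have := Finset.card_le_card hts
      omega
    rw [if_neg this]
    exact k3 t hts ht

theorem IsCompatible.exists_glue {X : Type*} [TopologicalSpace X] [Nonempty X]
    {S : PreAbstractSimplicialComplex ℕ} {Z : Finset ℕ → Set X} {n : ℕ}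
    {φ : Finset ℕ → (ℕ → ℝ) → X} (hφ : IsCompatible S Z n φ) {T : Set (Finset ℕ)}
    (hT : T.Finite) (hTS : T ⊆ S.faces) (hTn : ∀ s ∈ T, s.card ≤ n) :
    ∃ F : (ℕ → ℝ) → X, ContinuousOn F (⋃ s ∈ T, geomSimplex s) ∧
      ∀ s ∈ T, Set.EqOn F (φ s) (geomSimplex s) := by
  refine _root_.exists_glue hT φ (fun s hs => (hφ s (hTS hs) (hTn s hs)).1) ?_
  intro s hs t ht w hws hwt
  have hw := geomSimplex_inter hws hwt
  have hne := nonempty_of_mem_geomSimplex hw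
  rw [(hφ s (hTS hs) (hTn s hs)).2.2 _ Finset.inter_subset_left hne hw,
    (hφ t (hTS ht) (hTn t ht)).2.2 _ Finset.inter_subset_right hne hw]

/-- A simplex with at least four vertices has a boundary sphere of dimension at least two. By
monotonicity of `Z` the map already defined there lands in the aspherical set `Z s`. -/
theorem IsCompatible.exists_of_aspherical {X : Type*} [TopologicalSpace X] [Nonempty X]
    {S : PreAbstractSimplicialComplex ℕ} {Z : Finset ℕ → Set X}
    (hmono : ∀ s ∈ S.faces, ∀ t ⊆ s, Z t ⊆ Z s) (hZ : ∀ s ∈ S.faces, IsAspherical (Z s))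
    {φ : Finset ℕ → (ℕ → ℝ) → X} (hφ : IsCompatible S Z 3 φ) (k : ℕ) :
    ∃ φ', IsCompatible S Z (k + 3) φ' := by
  induction k with
  | zero => exact ⟨φ, hφ⟩
  | succ k ih =>
    obtain ⟨φ', hφ'⟩ := ih
    refine IsCompatible.exists_succ hφ' fun s hs hcard => ?_
    have hTs : {t | t ⊂ s ∧ t.Nonempty} ⊆ S.faces := fun t ht => face_subset hs ht.1.1 ht.2
    have hTn : ∀ t ∈ {t | t ⊂ s ∧ t.Nonempty}, t.card ≤ k + 3 := fun t ht => by
      have := Finset.card_lt_card ht.1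
      omega
    obtain ⟨b, hb, hbφ⟩ := hφ'.exists_glue
      ((Finset.finite_toSet s.powerset).subset fun t ht => by simpa using ht.1.1) hTs hTn
    have hbd : ∀ w ∈ simplexBoundary s, ∃ t, (t ⊂ s ∧ t.Nonempty) ∧ w ∈ geomSimplex t := by
      rintro w ⟨hw, v, hv, hv0⟩
      have hw' : w ∈ geomSimplex (s.erase v) := by
        refine mem_geomSimplex_of_subset hw (Finset.erase_subset _ _) fun u hu hu' => ?_
        rw [Finset.mem_erase, not_and_or, not_not] at hu'
        rw [hu'.resolve_right (not_not.2 hu), hv0]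
      exact ⟨_, ⟨Finset.erase_ssubset hv, nonempty_of_mem_geomSimplex hw'⟩, hw'⟩
    obtain ⟨ψ, h1, h2, h3⟩ := (hZ s hs).exists_extension (show 4 ≤ s.card by omega)
      (hb.mono fun w hw => by
        obtain ⟨t, ht, hwt⟩ := hbd w hw
        exact Set.mem_biUnion ht hwt)
      (fun w hw => by
        obtain ⟨t, ht, hwt⟩ := hbd w hw
        rw [hbφ t ht hwt]
        exact hmono s hs t ht.1.1 ((hφ' t (hTs ht) (hTn t ht)).2.1 hwt))
    refine ⟨ψ, h1, h2, fun t hts ht w hw => ?_⟩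
    rw [h3, hbφ t ⟨hts, ht⟩ hw]
    obtain ⟨v, hv, hvt⟩ := Finset.exists_of_ssubset hts
    exact ⟨geomSimplex_mono hts.1 hw, v, hv, hw.2.1 v hvt⟩

/-- The map on an edge given by a choice of paths. -/
noncomputable def Fillings.edgeMap {X : Type*} [MetricSpace X] {r C : ℝ} (Φ : Fillings X r C)
    (f : ℕ → X) (s : Finset ℕ) (w : ℕ → ℝ) : X :=
  -- The order of the labels orients the edge. A single vertex counts as an edge with equal ends;
  -- its weight is one, which gives the end of the path, hence `pt`.
  Φ.path (f (sInf (s : Set ℕ))) (f (s.sup id)) (w (s.sup id))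

theorem Fillings.edgeMap_pair {X : Type*} [MetricSpace X] {r C : ℝ} (Φ : Fillings X r C)
    (f : ℕ → X) {a b : ℕ} (hab : a ≤ b) (w : ℕ → ℝ) :
    Φ.edgeMap f {a, b} w = Φ.path (f a) (f b) (w b) := by
  have h1 : sInf ((({a, b} : Finset ℕ)) : Set ℕ) = a := by
    rw [Finset.coe_pair, csInf_pair]
    exact inf_eq_left.2 hab
  have h2 : ({a, b} : Finset ℕ).sup id = b := by simp [hab]
  rw [edgeMap, h1, h2]

theorem Fillings.edgeMap_singleton {X : Type*} [MetricSpace X] {r C : ℝ} (Φ : Fillings X r C)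
    (f : ℕ → X) (a : ℕ) {w : ℕ → ℝ} (hw : w ∈ geomSimplex {a}) :
    Φ.edgeMap f {a} w = Φ.pt (f a) := by
  have := Φ.edgeMap_pair f le_rfl (a := a) w
  rw [Finset.pair_eq_singleton] at this
  rw [this, eq_single_of_mem_geomSimplex hw, Pi.single_eq_same, Φ.path_one]

theorem Fillings.isCompatible_edgeMap {X : Type*} [MetricSpace X] {r C : ℝ} (Φ : Fillings X r C)
    {S : PreAbstractSimplicialComplex ℕ} {f : ℕ → X}
    (hf : ∀ s ∈ S.faces, ∀ u ∈ s, ∀ v ∈ s, dist (f u) (f v) ≤ r) {Z : Finset ℕ → Set X}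
    (hZ : ∀ s ∈ S.faces, ∀ v ∈ s, closedBall (f v) C ⊆ Z s) :
    IsCompatible S Z 2 (Φ.edgeMap f) := by
  intro s hs hcard
  obtain ⟨a, b, hab, rfl⟩ : ∃ a b, a ≤ b ∧ s = {a, b} := by
    have hpos := Finset.card_pos.2 (face_nonempty hs)
    obtain h | h : s.card = 1 ∨ s.card = 2 := by omega
    · obtain ⟨a, rfl⟩ := Finset.card_eq_one.1 h
      exact ⟨a, a, le_rfl, by simp⟩
    · obtain ⟨a, b, -, rfl⟩ := Finset.card_eq_two.1 h
      rcases le_total a b with hab | hab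
      · exact ⟨a, b, hab, rfl⟩
      · exact ⟨b, a, hab, Finset.pair_comm a b⟩
  have hpair := fun w => Φ.edgeMap_pair f hab w
  refine ⟨?_, fun w hw => ?_, fun t hts ht w hw => ?_⟩
  · have : Φ.edgeMap f {a, b} = fun w => Φ.path (f a) (f b) (w b) := funext hpair
    rw [this]
    exact ((Φ.continuous_path _ _).comp (continuous_apply b)).continuousOn
  · rw [hpair]
    exact hZ _ hs a (by simp) (Φ.dist_path _ _ (hf _ hs a (by simp) b (by simp)) _
      ⟨hw.1 b, le_one_of_mem_geomSimplex hw b⟩)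
  · have hcases : t = {a} ∨ t = {b} ∨ t = {a, b} := by
      by_cases ha : a ∈ t <;> by_cases hb : b ∈ t
      · exact Or.inr (Or.inr (hts.antisymm (by simp [Finset.insert_subset_iff, ha, hb])))
      · left
        ext v
        have := @hts v
        grind
      · right; left
        ext v
        have := @hts v
        grind
      · obtain ⟨v, hv⟩ := ht
        have := hts hv
        grind
    rcases hcases with rfl | rfl | rfl
    · rw [Φ.edgeMap_singleton f a hw, hpair, eq_single_of_mem_geomSimplex hw]
      by_cases h : b = a
      · subst h
        rw [Pi.single_eq_same, Φ.path_one]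
      · rw [Pi.single_eq_of_ne h, Φ.path_zero]
    · rw [Φ.edgeMap_singleton f b hw, hpair, eq_single_of_mem_geomSimplex hw,
        Pi.single_eq_same, Φ.path_one]
    · rfl

/-- The vertices of each triangle are listed in increasing order, so that the three sides of its
filling agree with the oriented edge maps. -/
theorem Fillings.exists_isCompatible_three {X : Type*} [MetricSpace X] {r C : ℝ}
    (Φ : Fillings X r C) {S : PreAbstractSimplicialComplex ℕ} {f : ℕ → X}
    (hf : ∀ s ∈ S.faces, ∀ u ∈ s, ∀ v ∈ s, dist (f u) (f v) ≤ r) {Z : Finset ℕ → Set X}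
    (hZ : ∀ s ∈ S.faces, ∀ v ∈ s, closedBall (f v) C ⊆ Z s) :
    ∃ φ, IsCompatible S Z 3 φ := by
  have h2 := Φ.isCompatible_edgeMap hf hZ
  have : Nonempty X := ⟨f 0⟩
  refine h2.exists_succ fun s hs hcard => ?_
  obtain ⟨a, b, c, hab, hbc, rfl⟩ : ∃ a b c, a < b ∧ b < c ∧ s = {a, b, c} := by
    let o := s.orderEmbOfFin hcard
    refine ⟨o 0, o 1, o 2, o.strictMono (by decide), o.strictMono (by decide), ?_⟩
    ext v
    rw [← Finset.mem_coe, ← Finset.range_orderEmbOfFin s hcard]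
    simp only [Set.mem_range, Fin.exists_fin_succ, Finset.mem_insert, Finset.mem_singleton]
    simp [o, eq_comm]
  have hac := hab.trans hbc
  obtain ⟨ψ, hψ, hψC, hc, ha, hb⟩ := Φ.exists_triangle (hf _ hs a (by simp) b (by simp))
    (hf _ hs b (by simp) c (by simp)) (hf _ hs a (by simp) c (by simp)) hab.ne hbc.ne hac.ne
  have key : ∀ x y, x ≤ y → ({x, y} : Finset ℕ) ⊆ {a, b, c} →
      (∀ w ∈ geomSimplex {x, y}, ψ w = Φ.path (f x) (f y) (w y)) →
      ∀ t ⊆ {x, y}, t.Nonempty → Set.EqOn ψ (Φ.edgeMap f t) (geomSimplex t) := by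
    intro x y hxy hsub h t ht hne w hw
    rw [h w (geomSimplex_mono ht hw), ← Φ.edgeMap_pair f hxy]
    exact (h2 _ (face_subset hs hsub (by simp)) Finset.card_le_two).2.2 t ht hne hw
  refine ⟨ψ, hψ, fun w hw => hZ _ hs a (by simp) (hψC w hw), fun t hts ht => ?_⟩
  obtain ⟨v, hv, hvt⟩ := Finset.exists_of_ssubset hts
  have hsub := hts.1
  simp only [Finset.mem_insert, Finset.mem_singleton] at hv
  rcases hv with rfl | rfl | rfl
  · have h1 : ({b, c} : Finset ℕ) ⊆ {v, b, c} := by simp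
    refine key b c hbc.le h1 (fun w hw => ha w (geomSimplex_mono h1 hw) (hw.2.1 v ?_)) t ?_ ht
    · simp [hab.ne, hac.ne]
    · intro u hu
      have := hsub hu
      grind
  · have h1 : ({a, c} : Finset ℕ) ⊆ {a, v, c} := by grind
    refine key a c hac.le h1 (fun w hw => hb w (geomSimplex_mono h1 hw) (hw.2.1 v ?_)) t ?_ ht
    · simp [hab.ne', hbc.ne]
    · intro u hu
      have := hsub hu
      grind
  · have h1 : ({a, b} : Finset ℕ) ⊆ {a, b, v} := by grind
    refine key a b hab.le h1 (fun w hw => hc w (geomSimplex_mono h1 hw) (hw.2.1 v ?_)) t ?_ ht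
    · simp [hac.ne', hbc.ne']
    · intro u hu
      have := hsub hu
      grind

/-- A map from the vertices of `S` extends to a continuous map on its realization which sends each
simplex `s` into the prescribed aspherical set `Z s`. -/
theorem Fillings.exists_map {X : Type*} [MetricSpace X] [Nonempty X] {r C : ℝ}
    (Φ : Fillings X r C) {S : PreAbstractSimplicialComplex ℕ} (hS : S.faces.Finite) {f : ℕ → X}
    (hf : ∀ s ∈ S.faces, ∀ u ∈ s, ∀ v ∈ s, dist (f u) (f v) ≤ r) {Z : Finset ℕ → Set X}
    (hmono : ∀ s ∈ S.faces, ∀ t ⊆ s, Z t ⊆ Z s) (hasph : ∀ s ∈ S.faces, IsAspherical (Z s))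
    (hZ : ∀ s ∈ S.faces, ∀ v ∈ s, closedBall (f v) C ⊆ Z s) :
    ∃ F : (ℕ → ℝ) → X, ContinuousOn F (realization S) ∧
      ∀ s ∈ S.faces, Set.MapsTo F (geomSimplex s) (Z s) := by
  obtain ⟨φ, hφ⟩ := Φ.exists_isCompatible_three hf hZ
  obtain ⟨k, hk⟩ := (hS.image Finset.card).bddAbove
  obtain ⟨φ', hφ'⟩ := hφ.exists_of_aspherical hmono hasph k
  have hcard : ∀ s ∈ S.faces, s.card ≤ k + 3 := fun s hs =>
    (hk (Set.mem_image_of_mem _ hs)).trans (Nat.le_add_right _ _)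
  obtain ⟨F, hF, hFφ⟩ := hφ'.exists_glue hS subset_rfl hcard
  rw [← realization_eq_iUnion] at hF
  refine ⟨F, hF, fun s hs w hw => ?_⟩
  rw [hFφ s hs hw]
  exact (hφ' s hs (hcard s hs)).2.1 hw

/-! ### Asymptotic hereditary asphericity from fillings -/

/-- `D` may be negative, hence the maximum. The extra `1` is there because the distance to `W` need
not be attained. -/
theorem exists_dist_lt_of_mem_cthickening {X : Type*} [MetricSpace X] {D C : ℝ} (hC : 0 ≤ C)
    {W : Set X} {y : X} (hy : y ∈ cthickening D (cthickening C W)) :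
    ∃ w ∈ W, dist y w < max D 0 + C + 1 := by
  have h1 := cthickening_mono (le_max_left D 0) _ hy
  have h2 := cthickening_cthickening_subset (le_max_right D 0) hC W h1
  have hpos : 0 ≤ max D 0 := le_max_right _ _
  have h3 := cthickening_subset_thickening' (δ₂ := max D 0 + C + 1) (by linarith) (by linarith) W h2
  obtain ⟨w, hw, hd⟩ := mem_thickening_iff.1 h3
  exact ⟨w, hw, hd⟩

/-- Pairs with images at distance at least one form a compact set disjoint from the diagonal. There
`sqDist` has a positive minimum, because points of `K` are determined by their first `N`
coordinates. -/
theorem exists_sqDist_modulus {X : Type*} [MetricSpace X] {K : Set (ℕ → ℝ)} (hK : IsCompact K)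
    {N : ℕ} (hN : ∀ w ∈ K, ∀ i, N ≤ i → w i = 0) (F : C(K, X)) :
    ∃ ε : ℝ, 0 < ε ∧ ∀ x y : K, sqDist N x y ≤ ε → dist (F x) (F y) ≤ 1 := by
  have : CompactSpace K := isCompact_iff_compactSpace.1 hK
  let B : Set (K × K) := {z | 1 ≤ dist (F z.1) (F z.2)}
  have hB : IsCompact B := (isClosed_le continuous_const (by fun_prop)).isCompact
  have hq : Continuous fun z : K × K => sqDist N z.1 z.2 :=
    (continuous_sqDist N).comp (f := fun z : K × K => ((z.1 : ℕ → ℝ), (z.2 : ℕ → ℝ)))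
      (by fun_prop)
  rcases B.eq_empty_or_nonempty with h | h
  · refine ⟨1, one_pos, fun x y _ => ?_⟩
    by_contra hlt
    have : (x, y) ∈ B := (not_le.1 hlt).le
    rw [h] at this
    exact this
  · obtain ⟨z, hz, hmin⟩ := hB.exists_isMinOn h hq.continuousOn
    have hpos : 0 < sqDist N z.1 z.2 := by
      refine lt_of_le_of_ne (sqDist_nonneg _ _ _) fun h0 => ?_
      have heq := eq_of_sqDist_eq_zero (hN _ z.1.2) (hN _ z.2.2) h0.symm
      have hz1 : 1 ≤ dist (F z.1) (F z.2) := hz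
      rw [Subtype.ext heq, dist_self] at hz1
      linarith
    refine ⟨sqDist N z.1 z.2 / 2, half_pos hpos, fun x y hxy => ?_⟩
    by_contra hlt
    have h1 : (x, y) ∈ B := (not_le.1 hlt).le
    have := isMinOn_iff.1 hmin _ h1
    simp only at this
    linarith

/-- A space with a monotone assignment of aspherical neighbourhoods of subsets in which triangles
can be filled at controlled distance is asymptotically hereditarily aspherical. -/
theorem isAHA_of_fillings {X : Type*} [MetricSpace X] [Nonempty X] {Y : Set X → Set X} {D : ℝ}
    (hsub : ∀ A : Set X, A ⊆ Y A) (hnear : ∀ A : Set X, Y A ⊆ cthickening D A)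
    (hasph : ∀ A : Set X, IsAspherical (Y A)) (hmono : ∀ A₁ A₂ : Set X, A₁ ⊆ A₂ → Y A₁ ⊆ Y A₂)
    (hfill : ∀ r : ℝ, 0 < r → ∃ C, Nonempty (Fillings X r C)) : IsAHA X := by
  classical
  intro r hr
  obtain ⟨C, ⟨Φ⟩⟩ := hfill r hr
  have hC : 0 ≤ C := by
    let x := Classical.arbitrary X
    exact dist_nonneg.trans (Φ.dist_path x x (by rw [dist_self]; exact hr.le) 0 (by simp))
  set E := max D 0 + C + 1 with hE
  have hEpos : 0 < E := by
    have : 0 ≤ max D 0 := le_max_right _ _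
    linarith
  have hYnear : ∀ W : Set X, ∀ y ∈ Y (cthickening C W), ∃ w ∈ W, dist y w < E := fun W y hy =>
    exists_dist_lt_of_mem_cthickening hC (hnear _ hy)
  -- Each comparison of a label with an image costs at most `E`; the images of adjacent interior
  -- vertices differ by at most `1`, and two vertices of a simplex of `S` by at most `r`.
  refine ⟨2 * E + r + 1, by linarith, fun A i hi S f hS hf => ?_⟩
  have hfA : ∀ s ∈ S.faces, ∀ v ∈ s, f v ∈ A := fun s hs v hv =>
    (hf s hs).2.1 (Finset.mem_coe.2 (Finset.mem_image_of_mem f hv))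
  have hfr : ∀ s ∈ S.faces, ∀ u ∈ s, ∀ v ∈ s, dist (f u) (f v) ≤ r := fun s hs u hu v hv =>
    (hf s hs).2.2 _ (Finset.mem_image_of_mem f hu) _ (Finset.mem_image_of_mem f hv)
  -- The target depends on `s`, and is not just `Y` of a neighbourhood of `A`, so that `F` on `s`
  -- remains near `f(s)`. The edges meeting the boundary need this.
  obtain ⟨F, hF, hFZ⟩ := Φ.exists_map hS.1 hfr (Z := fun s => Y (cthickening C (f '' s)))
    (fun s _ t hts => hmono _ _ (cthickening_subset_of_subset _
      (Set.image_mono (Finset.coe_subset.2 hts)))) (fun s _ => hasph _)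
    (fun s _ v hv x hx => hsub _ (mem_cthickening_of_dist_le x (f v) C _ ⟨v, hv, rfl⟩ hx))
  have hFA : ∀ w ∈ realization S, F w ∈ Y (cthickening C A) := by
    rintro w ⟨s, hs, hw⟩
    refine hmono _ _ (cthickening_subset_of_subset _ ?_) (hFZ s hs hw)
    rintro _ ⟨v, hv, rfl⟩
    exact hfA s hs v hv
  obtain ⟨p, hp⟩ := exists_fresh hS.1
  obtain ⟨hCfin, -, h, hh⟩ := hS.cone hp
  have hsymm : ∀ z : sphere (0 : EuclideanSpace ℝ (Fin (i + 1))) 1,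
      (h.symm ⟨z, sphere_subset_closedBall z.2⟩ : ℕ → ℝ) ∈ realization S := fun z => by
    rw [← hh, Homeomorph.apply_symm_apply]
    exact z.2
  let g : C(sphere (0 : EuclideanSpace ℝ (Fin (i + 1))) 1, Y (cthickening C A)) :=
    ⟨fun z => ⟨F (h.symm ⟨z, sphere_subset_closedBall z.2⟩), hFA _ (hsymm z)⟩, by
      refine Continuous.subtype_mk ?_ _
      exact hF.comp_continuous (by fun_prop) hsymm⟩
  obtain ⟨G, hG⟩ := hasph (cthickening C A) i hi g
  let F' : C(realization (coneComplex S p), X) :=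
    ⟨fun w => G (h w), continuous_subtype_val.comp (G.continuous.comp h.continuous)⟩
  have hF'S : ∀ w : realization (coneComplex S p), (w : ℕ → ℝ) ∈ realization S → F' w = F w := by
    intro w hw
    have := hG (h w) ⟨h w, (hh w).2 hw⟩ rfl
    change ((G (h w) : Y (cthickening C A)) : X) = _
    rw [this]
    change F (h.symm (h w)) = F w
    rw [Homeomorph.symm_apply_apply]
  obtain ⟨N, hN⟩ := (finite_vertexSet hCfin).bddAbove
  -- `N` bounds the vertex labels, so coordinates vanish only from `N + 1` on.
  obtain ⟨ε, hε, hmod⟩ := exists_sqDist_modulus (isCompact_realization hCfin) (N := N + 1)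
    (fun w hw j hj => eq_zero_of_mem_realization hw fun hj' => by
      have := hN hj'
      omega) F'
  obtain ⟨K, pos, hK, hKε⟩ := exists_fine_isPositioned hS hp (N + 1) hε
  have hlab : ∀ w : ℕ → ℝ, ∃ a : X, ∀ hw : w ∈ realization (coneComplex S p),
      a ∈ A ∧ dist (F' ⟨w, hw⟩) a < E := by
    intro w
    by_cases hw : w ∈ realization (coneComplex S p)
    · obtain ⟨a, ha, hd⟩ := hYnear A (F' ⟨w, hw⟩) (G (h ⟨w, hw⟩)).2
      exact ⟨a, fun _ => ⟨ha, hd⟩⟩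
    · exact ⟨f 0, fun h => absurd h hw⟩
  choose a ha using hlab
  let lab : ℕ → X := fun v => if v ∈ vertexSet S then f v else a (pos v)
  have hlabS : ∀ v, v ∈ vertexSet S → lab v = f v := fun v hv => if_pos hv
  have hlabN : ∀ v, v ∉ vertexSet S → lab v = a (pos v) := fun v hv => if_neg hv
  -- With both positions in `s`, the image of `pos v` is within `E` of some `f x` with `x` in `s`,
  -- and `f x` is within `r` of `f u`. No fineness enters.
  have hmixed : ∀ u v, ∀ s ∈ S.faces, u ∈ vertexSet S → v ∉ vertexSet S →
      pos u ∈ geomSimplex s → pos v ∈ geomSimplex s → dist (lab u) (lab v) ≤ 2 * E + r + 1 := by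
    intro u v s hs hu hv hus hvs
    rw [hK.boundary u hu, single_mem_geomSimplex] at hus
    have hvS : pos v ∈ realization S := ⟨s, hs, hvs⟩
    have hvC : pos v ∈ realization (coneComplex S p) :=
      geomSimplex_subset_realization (le_coneComplex hp hs) hvs
    obtain ⟨_, ⟨x, hx, rfl⟩, hd⟩ := hYnear _ _ (hFZ s hs hvs)
    have h1 := (ha (pos v) hvC).2
    rw [hF'S _ hvS] at h1
    have h2 := hfr s hs u hus x hx
    rw [hlabS u hu, hlabN v hv]
    have h3 := dist_triangle (f u) (f x) (a (pos v))
    have h4 := dist_triangle_left (f x) (a (pos v)) (F (pos v))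
    simp only at h1
    linarith
  refine ⟨K, lab, hK.ball, fun t ht => ⟨(face_nonempty ht).image _, ?_, ?_⟩, hlabS⟩
  · intro x hx
    obtain ⟨v, hv, rfl⟩ := Finset.mem_image.1 (Finset.mem_coe.1 hx)
    by_cases hvS : v ∈ vertexSet S
    · rw [hlabS v hvS]
      exact hfA _ hvS v (by simp)
    · obtain ⟨ρ, hρ, hρt, -⟩ := hK.carried t ht
      rw [hlabN v hvS]
      exact (ha _ (geomSimplex_subset_realization hρ (hρt v hv))).1
  · intro x hx y hy
    obtain ⟨u, hu, rfl⟩ := Finset.mem_image.1 hx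
    obtain ⟨v, hv, rfl⟩ := Finset.mem_image.1 hy
    obtain ⟨ρ, hρ, hρt, hρS⟩ := hK.carried t ht
    by_cases huS : u ∈ vertexSet S
    · have hρS' := hρS ⟨u, hu, huS⟩
      by_cases hvS : v ∈ vertexSet S
      · have h1 := hρt u hu
        have h2 := hρt v hv
        rw [hK.boundary u huS, single_mem_geomSimplex] at h1
        rw [hK.boundary v hvS, single_mem_geomSimplex] at h2
        have := hfr ρ hρS' u h1 v h2
        rw [hlabS u huS, hlabS v hvS]
        linarith
      · exact hmixed u v ρ hρS' huS hvS (hρt u hu) (hρt v hv)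
    · by_cases hvS : v ∈ vertexSet S
      · rw [dist_comm]
        exact hmixed v u ρ (hρS ⟨v, hv, hvS⟩) hvS huS (hρt v hv) (hρt u hu)
      · have huC := geomSimplex_subset_realization hρ (hρt u hu)
        have hvC := geomSimplex_subset_realization hρ (hρt v hv)
        have huv : {u, v} ∈ K.faces :=
          face_subset ht (by simp [Finset.insert_subset_iff, hu, hv]) (by simp)
        have h1 := hmod ⟨_, huC⟩ ⟨_, hvC⟩ (hKε u v huS hvS huv)
        have h2 := (ha _ huC).2
        have h3 := (ha _ hvC).2
        rw [hlabN u huS, hlabN v hvS]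
        have h4 := dist_triangle_left (a (pos u)) (a (pos v)) (F' ⟨_, huC⟩)
        have h5 := dist_triangle (F' ⟨_, huC⟩) (F' ⟨_, hvC⟩) (a (pos v))
        linarith

/-! ### Fillings from a finite filling radius -/

/-- Two paths with common endpoints form a loop, traversed on the two halves of the circle. -/
theorem exists_loop {X : Type*} [TopologicalSpace X] {γ₀ γ₁ : ℝ → X} (h₀ : Continuous γ₀)
    (h₁ : Continuous γ₁) (hzero : γ₀ 0 = γ₁ 0) (hone : γ₀ 1 = γ₁ 1) :
    ∃ f : C(Circle, X), (∀ t ∈ Set.Icc (0 : ℝ) 1, f (Circle.exp (Real.pi * t)) = γ₀ t) ∧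
      (∀ t ∈ Set.Icc (0 : ℝ) 1, f (Circle.exp (-(Real.pi * t))) = γ₁ t) ∧
      ∀ ζ, ∃ t ∈ Set.Icc (0 : ℝ) 1, f ζ = γ₀ t ∨ f ζ = γ₁ t := by
  have hpi := Real.pi_pos
  -- The same parameter serves both half circles; they meet where it is `0` or `1`, and there the
  -- two paths agree.
  let τ : Circle → ℝ := fun ζ => Real.arccos (ζ : ℂ).re / Real.pi
  have hτ : Continuous τ := by
    have : Continuous fun ζ : Circle => (ζ : ℂ).re :=
      Complex.continuous_re.comp continuous_subtype_val
    exact (Real.continuous_arccos.comp this).div_const _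
  have him : Continuous fun ζ : Circle => (ζ : ℂ).im :=
    Complex.continuous_im.comp continuous_subtype_val
  have hagree : ∀ ζ : Circle, (ζ : ℂ).im = 0 → γ₀ (τ ζ) = γ₁ (τ ζ) := by
    intro ζ hζ
    have h1 := Circle.normSq_coe ζ
    rw [Complex.normSq_apply, hζ, mul_zero, add_zero, ← sq, sq_eq_one_iff] at h1
    rcases h1 with h | h
    · simp only [τ, h, Real.arccos_one, zero_div, hzero]
    · simp only [τ, h, Real.arccos_neg_one, div_self hpi.ne', hone]
  let f : Circle → X := fun ζ => if 0 ≤ (ζ : ℂ).im then γ₀ (τ ζ) else γ₁ (τ ζ)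
  have hf : Continuous f :=
    Continuous.if_le (h₀.comp hτ) (h₁.comp hτ) continuous_const him fun ζ h => hagree ζ h.symm
  have hre : ∀ θ : ℝ, (Circle.exp θ : ℂ).re = Real.cos θ := fun θ => by
    rw [Circle.coe_exp, Complex.exp_ofReal_mul_I_re]
  have him' : ∀ θ : ℝ, (Circle.exp θ : ℂ).im = Real.sin θ := fun θ => by
    rw [Circle.coe_exp, Complex.exp_ofReal_mul_I_im]
  have hmul : ∀ t ∈ Set.Icc (0 : ℝ) 1, 0 ≤ Real.pi * t ∧ Real.pi * t ≤ Real.pi := fun t ht =>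
    ⟨mul_nonneg hpi.le ht.1, mul_le_of_le_one_right hpi.le ht.2⟩
  refine ⟨⟨f, hf⟩, fun t ht => ?_, fun t ht => ?_, fun ζ => ⟨τ ζ, ⟨?_, ?_⟩, ?_⟩⟩
  · obtain ⟨h1, h2⟩ := hmul t ht
    have hτt : τ (Circle.exp (Real.pi * t)) = t := by
      simp only [τ, hre, Real.arccos_cos h1 h2]
      field_simp
    change f _ = _
    simp only [f, him', if_pos (Real.sin_nonneg_of_nonneg_of_le_pi h1 h2), hτt]
  · obtain ⟨h1, h2⟩ := hmul t ht
    have hτt : τ (Circle.exp (-(Real.pi * t))) = t := by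
      simp only [τ, hre, Real.cos_neg, Real.arccos_cos h1 h2]
      field_simp
    have hsin := Real.sin_nonneg_of_nonneg_of_le_pi h1 h2
    change f _ = _
    by_cases h0 : Real.sin (Real.pi * t) = 0
    · have := hagree (Circle.exp (-(Real.pi * t))) (by rw [him', Real.sin_neg, h0, neg_zero])
      simp only [f, him', Real.sin_neg, h0, neg_zero, le_refl, if_true]
      rw [this, hτt]
    · have : ¬ 0 ≤ - Real.sin (Real.pi * t) := by
        rw [not_le, neg_lt_zero]
        exact lt_of_le_of_ne hsin (Ne.symm h0)
      simp only [f, him', Real.sin_neg, if_neg this, hτt]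
  · exact div_nonneg (Real.arccos_nonneg _) hpi.le
  · exact div_le_one_of_le₀ (Real.arccos_le_pi _) hpi.le
  · change f ζ = _ ∨ f ζ = _
    by_cases h : 0 ≤ (ζ : ℂ).im
    · exact Or.inl (if_pos h)
    · exact Or.inr (if_neg h)

/-- A filling of the loop formed by two paths gives a homotopy between them. -/
theorem exists_homotopy_of_extendsLoop {X : Type*} [TopologicalSpace X] {γ₀ γ₁ : ℝ → X}
    {f : C(Circle, X)} (h₀ : ∀ t ∈ Set.Icc (0 : ℝ) 1, f (Circle.exp (Real.pi * t)) = γ₀ t)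
    (h₁ : ∀ t ∈ Set.Icc (0 : ℝ) 1, f (Circle.exp (-(Real.pi * t))) = γ₁ t)
    {F : C(closedBall (0 : ℂ) 1, X)} (hF : ExtendsLoop F f) :
    ∃ H : ℝ × ℝ → X, Continuous H ∧ (∀ z, H z ∈ Set.range F) ∧
      (∀ s, H (s, 0) = γ₀ 0) ∧ (∀ s, H (s, 1) = γ₀ 1) ∧
      (∀ t ∈ Set.Icc (0 : ℝ) 1, H (0, t) = γ₀ t) ∧
      ∀ t ∈ Set.Icc (0 : ℝ) 1, H (1, t) = γ₁ t := by
  let c : ℝ → ℝ := fun s => 1 - 2 * (Set.projIcc (0 : ℝ) 1 zero_le_one s : ℝ)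
  have hc : Continuous c :=
    continuous_const.sub (continuous_const.mul (continuous_subtype_val.comp continuous_projIcc))
  have hc1 : ∀ s, |c s| ≤ 1 := fun s => by
    have h := (Set.projIcc (0 : ℝ) 1 zero_le_one s).2
    rw [abs_le]
    constructor <;> simp only [c] <;> linarith [h.1, h.2]
  have hc0 : c 0 = 1 := by simp [c]
  have hc1' : c 1 = -1 := by simp [c]; norm_num
  -- For fixed `t`, the point descends the vertical chord of the disk from the upper to the lower
  -- half circle as `s` runs from `0` to `1`. The chords degenerate at `t = 0` and `t = 1`.
  let ζ : ℝ × ℝ → ℂ := fun z => ⟨Real.cos (Real.pi * z.2), c z.1 * Real.sin (Real.pi * z.2)⟩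
  have hζ : Continuous ζ := by
    have : Continuous fun z : ℝ × ℝ => (Complex.equivRealProdCLM.symm
      (Real.cos (Real.pi * z.2), c z.1 * Real.sin (Real.pi * z.2))) :=
      Complex.equivRealProdCLM.symm.continuous.comp (by fun_prop)
    exact this
  have hζ1 : ∀ z, ζ z ∈ closedBall (0 : ℂ) 1 := fun z => by
    rw [mem_closedBall_zero_iff, ← sq_le_one_iff₀ (norm_nonneg _), Complex.sq_norm,
      Complex.normSq_apply]
    have h1 := (sq_le_one_iff_abs_le_one _).2 (hc1 z.1)
    have h2 := Real.sin_sq_add_cos_sq (Real.pi * z.2)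
    simp only [ζ]
    nlinarith [mul_nonneg (sub_nonneg.2 h1) (sq_nonneg (Real.sin (Real.pi * z.2)))]
  have hexp : ∀ θ : ℝ, (Circle.exp θ : ℂ) = ⟨Real.cos θ, Real.sin θ⟩ := fun θ => by
    apply Complex.ext
    · rw [Circle.coe_exp, Complex.exp_ofReal_mul_I_re]
    · rw [Circle.coe_exp, Complex.exp_ofReal_mul_I_im]
  have hup : ∀ t ∈ Set.Icc (0 : ℝ) 1, ∀ w : closedBall (0 : ℂ) 1,
      (w : ℂ) = Circle.exp (Real.pi * t) → F w = γ₀ t :=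
    fun t ht w hw => (hF _ _ hw).trans (h₀ t ht)
  refine ⟨fun z => F ⟨ζ z, hζ1 z⟩, F.continuous.comp (hζ.subtype_mk _), fun z => ⟨_, rfl⟩,
    fun s => hup 0 (by simp) _ ?_, fun s => hup 1 (by simp) _ ?_, fun t ht => hup t ht _ ?_,
    fun t ht => ((hF _ (Circle.exp (-(Real.pi * t))) ?_).trans (h₁ t ht))⟩
  · rw [hexp]; simp [ζ]
  · rw [hexp]; simp [ζ]
  · rw [hexp]; simp [ζ, hc0]
  · rw [hexp]; simp [ζ, hc1']

theorem eVariationOn_le_of_dist {X : Type*} [MetricSpace X] {f : ℝ → X} {a b v : ℝ}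
    (h : ∀ s ∈ Set.Icc a b, ∀ t ∈ Set.Icc a b, dist (f s) (f t) = v * |s - t|) (hab : a < b) :
    eVariationOn f (Set.Icc a b) ≤ ENNReal.ofReal (v * (b - a)) := by
  have hv : 0 ≤ v := by
    have := h a ⟨le_rfl, hab.le⟩ b ⟨hab.le, le_rfl⟩
    have h2 : 0 < |a - b| := abs_pos.2 (sub_ne_zero.2 hab.ne)
    exact nonneg_of_mul_nonneg_left (this ▸ dist_nonneg) h2
  have hlip : LipschitzOnWith v.toNNReal f (Set.Icc a b) := by
    refine LipschitzOnWith.of_dist_le_mul fun s hs t ht => ?_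
    rw [h s hs t ht, Real.coe_toNNReal _ hv, Real.dist_eq]
  have h1 := hlip.comp_eVariationOn_le (g := id) (s := Set.Icc a b) fun x hx => hx
  have h2 := ((monotoneOn_id (s := Set.Icc a b)).eVariationOn_eq (a := a) (b := b)
    ⟨le_rfl, hab.le⟩ ⟨hab.le, le_rfl⟩).le
  rw [Set.inter_self] at h2
  rw [Function.comp_id] at h1
  refine h1.trans ((mul_le_mul_right h2 _).trans ?_)
  rw [ENNReal.ofReal_mul hv]
  rfl

/-- A geodesic is controlled only on its parameter interval. Rescaling to `[0, 1]` and precomposing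
with `projIcc` gives a path continuous on all of `ℝ`. -/
theorem exists_constantSpeed_path {X : Type*} [MetricSpace X] (h : IsGeodesicSpace X) (x y : X) :
    ∃ γ : ℝ → X, Continuous γ ∧ γ 0 = x ∧ γ 1 = y ∧
      ∀ s ∈ Set.Icc (0 : ℝ) 1, ∀ t ∈ Set.Icc (0 : ℝ) 1, dist (γ s) (γ t) = dist x y * |s - t| := by
  obtain ⟨γ, h0, h1, h2⟩ := h x y
  have hmem : ∀ t ∈ Set.Icc (0 : ℝ) 1, dist x y * t ∈ Set.Icc 0 (dist x y) := fun t ht =>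
    ⟨mul_nonneg dist_nonneg ht.1, mul_le_of_le_one_right dist_nonneg ht.2⟩
  have hd : ∀ s ∈ Set.Icc (0 : ℝ) 1, ∀ t ∈ Set.Icc (0 : ℝ) 1,
      dist (γ (dist x y * s)) (γ (dist x y * t)) = dist x y * |s - t| := fun s hs t ht => by
    rw [h2 _ (hmem s hs) _ (hmem t ht), ← mul_sub, abs_mul, abs_of_nonneg dist_nonneg]
  have hproj : ∀ t ∈ Set.Icc (0 : ℝ) 1, (Set.projIcc (0 : ℝ) 1 zero_le_one t : ℝ) = t :=
    fun t ht => by rw [Set.projIcc_of_mem _ ht]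
  refine ⟨fun t => γ (dist x y * (Set.projIcc (0 : ℝ) 1 zero_le_one t : ℝ)), ?_, ?_, ?_, ?_⟩
  · have hc : Continuous fun t : Set.Icc (0 : ℝ) 1 => γ (dist x y * t) := by
      refine (LipschitzWith.of_dist_le_mul (K := ⟨dist x y, dist_nonneg⟩) fun s t => ?_).continuous
      rw [hd _ s.2 _ t.2]
      exact le_rfl
    exact hc.comp continuous_projIcc
  · simp [h0]
  · simp [h1]
  · intro s hs t ht
    simp only [hproj s hs, hproj t ht]
    exact hd s hs t ht

/-- In a geodesic space with finite filling radius function, geodesic triangles can be filled. -/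
theorem exists_fillings_of_fillRad {X : Type*} [MetricSpace X] (hgeod : IsGeodesicSpace X) {r : ℝ}
    (hr : 0 < r) (hfill : fillRad X (3 * r) < ⊤) : ∃ C, Nonempty (Fillings X r C) := by
  choose γ hγ hγ0 hγ1 hγd using exists_constantSpeed_path hgeod
  -- The infimum over fillings need not be attained; the added `1` leaves room for an actual one.
  set M : ℝ := (fillRad X (3 * r)).toReal + 1 with hM
  have hM0 : 0 ≤ (fillRad X (3 * r)).toReal := ENNReal.toReal_nonneg
  have hγx : ∀ x y, dist x y ≤ r → ∀ t ∈ Set.Icc (0 : ℝ) 1, dist (γ x y t) x ≤ r := by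
    intro x y hxy t ht
    have := hγd x y t ht 0 (by simp)
    rw [hγ0] at this
    rw [this, sub_zero, abs_of_nonneg ht.1]
    exact (mul_le_of_le_one_right dist_nonneg ht.2).trans hxy
  -- The triangle stays within `2 * r` of `x`, and its filling within `M` of the triangle.
  refine ⟨M + 2 * r, ⟨⟨id, γ, hγ, hγ0, hγ1, fun x y hxy t ht => ?_, fun x y z hxy hyz hxz => ?_⟩⟩⟩
  · have := hγx x y hxy t ht
    linarith
  let γ₀ : ℝ → X := fun t => if t ≤ 1 / 2 then γ x y (2 * t) else γ y z (2 * t - 1)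
  have hγ₀l : ∀ t, t ≤ 1 / 2 → γ₀ t = γ x y (2 * t) := fun t ht => if_pos ht
  have hγ₀r : ∀ t, 1 / 2 ≤ t → γ₀ t = γ y z (2 * t - 1) := fun t ht => by
    rcases eq_or_lt_of_le ht with rfl | h
    · rw [hγ₀l _ le_rfl]
      norm_num [hγ0, hγ1]
    · exact if_neg (not_le.2 h)
  have hγ₀c : Continuous γ₀ := by
    refine Continuous.if_le ((hγ x y).comp (by fun_prop)) ((hγ y z).comp (by fun_prop))
      continuous_id continuous_const fun t ht => ?_
    rw [ht]
    norm_num [hγ0, hγ1]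
  have h00 : γ₀ 0 = x := by rw [hγ₀l 0 (by norm_num), mul_zero, hγ0]
  have h01 : γ₀ 1 = z := by
    rw [hγ₀r 1 (by norm_num), show (2 : ℝ) * 1 - 1 = 1 by norm_num, hγ1]
  obtain ⟨f, hf0, hf1, hfmem⟩ := exists_loop hγ₀c (hγ x z) (by rw [h00, hγ0]) (by rw [h01, hγ1])
  have hp0 : ∀ t ∈ Set.Icc (0 : ℝ) (1 / 2), loopParam f t = γ₀ (2 * t) := fun t ht => by
    rw [← hf0 (2 * t) ⟨by linarith [ht.1], by linarith [ht.2]⟩, loopParam]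
    congr 2
    ring
  have hp1 : ∀ t ∈ Set.Icc (1 / 2 : ℝ) 1, loopParam f t = γ x z (2 - 2 * t) := fun t ht => by
    rw [← hf1 (2 - 2 * t) ⟨by linarith [ht.2], by linarith [ht.1]⟩, loopParam]
    congr 1
    rw [← Circle.exp_sub_two_pi]
    congr 1
    ring
  have hd1 : ∀ a ∈ Set.Icc (0 : ℝ) (1 / 4), ∀ b ∈ Set.Icc (0 : ℝ) (1 / 4),
      dist (loopParam f a) (loopParam f b) = 4 * dist x y * |a - b| := by
    rintro a ⟨ha0, ha1⟩ b ⟨hb0, hb1⟩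
    rw [hp0 a ⟨ha0, by linarith⟩, hp0 b ⟨hb0, by linarith⟩, hγ₀l _ (by linarith),
      hγ₀l _ (by linarith), hγd x y _ ⟨by linarith, by linarith⟩ _ ⟨by linarith, by linarith⟩,
      show 2 * (2 * a) - 2 * (2 * b) = 4 * (a - b) by ring, abs_mul, abs_of_pos four_pos]
    ring
  have hd2 : ∀ a ∈ Set.Icc (1 / 4 : ℝ) (1 / 2), ∀ b ∈ Set.Icc (1 / 4 : ℝ) (1 / 2),
      dist (loopParam f a) (loopParam f b) = 4 * dist y z * |a - b| := by
    rintro a ⟨ha0, ha1⟩ b ⟨hb0, hb1⟩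
    rw [hp0 a ⟨by linarith, ha1⟩, hp0 b ⟨by linarith, hb1⟩, hγ₀r _ (by linarith),
      hγ₀r _ (by linarith), hγd y z _ ⟨by linarith, by linarith⟩ _ ⟨by linarith, by linarith⟩,
      show 2 * (2 * a) - 1 - (2 * (2 * b) - 1) = 4 * (a - b) by ring, abs_mul, abs_of_pos four_pos]
    ring
  have hd3 : ∀ a ∈ Set.Icc (1 / 2 : ℝ) 1, ∀ b ∈ Set.Icc (1 / 2 : ℝ) 1,
      dist (loopParam f a) (loopParam f b) = 2 * dist x z * |a - b| := by
    rintro a ⟨ha0, ha1⟩ b ⟨hb0, hb1⟩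
    rw [hp1 a ⟨ha0, ha1⟩, hp1 b ⟨hb0, hb1⟩,
      hγd x z _ ⟨by linarith, by linarith⟩ _ ⟨by linarith, by linarith⟩,
      show 2 - 2 * a - (2 - 2 * b) = -(2 * (a - b)) by ring, abs_neg, abs_mul, abs_of_pos two_pos]
    ring
  have hgeo : IsPiecewiseGeodesic f := by
    -- The two sides through `y` share the upper half circle, and the third side occupies the lower
    -- half, traversed backwards.
    refine ⟨3, fun i => if i = 0 then 0 else if i = 1 then 1 / 4 else if i = 2 then 1 / 2 else 1,
      monotone_nat_of_le_succ fun i => ?_, rfl, by norm_num, fun i hi => ?_⟩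
    · rcases i with _ | _ | _ | i
      · norm_num
      · norm_num
      · norm_num
      · simp
    · interval_cases i
      · exact ⟨_, by simpa using hd1⟩
      · exact ⟨_, by simpa using hd2⟩
      · exact ⟨_, by simpa using hd3⟩
  have hlen : loopLength f ≤ ENNReal.ofReal (3 * r) := by
    have e1 := eVariationOn.Icc_add_Icc (loopParam f) (s := Set.univ) (a := 0) (b := 1 / 4)
      (c := 1 / 2) (by norm_num) (by norm_num) trivial
    have e2 := eVariationOn.Icc_add_Icc (loopParam f) (s := Set.univ) (a := 0) (b := 1 / 2)
      (c := 1) (by norm_num) (by norm_num) trivial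
    simp only [Set.univ_inter] at e1 e2
    rw [loopLength, ← e2, ← e1]
    have hxy0 := dist_nonneg (x := x) (y := y)
    have hyz0 := dist_nonneg (x := y) (y := z)
    have hxz0 := dist_nonneg (x := x) (y := z)
    refine (add_le_add (add_le_add (eVariationOn_le_of_dist hd1 (by norm_num))
      (eVariationOn_le_of_dist hd2 (by norm_num)))
      (eVariationOn_le_of_dist hd3 (by norm_num))).trans ?_
    rw [← ENNReal.ofReal_add (by linarith) (by linarith),
      ← ENNReal.ofReal_add (by linarith) (by linarith)]
    exact ENNReal.ofReal_le_ofReal (by linarith)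
  have hrad : loopFillRad f < ENNReal.ofReal M := by
    have h1 : loopFillRad f ≤ fillRad X (3 * r) :=
      le_iSup_of_le f (le_iSup_of_le hgeo (le_iSup_of_le hlen le_rfl))
    refine h1.trans_lt ?_
    rw [ENNReal.lt_ofReal_iff_toReal_lt hfill.ne]
    linarith
  simp only [loopFillRad, iInf_lt_iff] at hrad
  obtain ⟨F, hF, hFM⟩ := hrad
  obtain ⟨H, hH, hHF, hs0, hs1, ht0, ht1⟩ := exists_homotopy_of_extendsLoop hf0 hf1 hF
  have hγ₀x : ∀ t ∈ Set.Icc (0 : ℝ) 1, dist (γ₀ t) x ≤ 2 * r := by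
    intro t ht
    rcases le_total t (1 / 2) with h | h
    · rw [hγ₀l t h]
      have := hγx x y hxy (2 * t) ⟨by linarith [ht.1], by linarith⟩
      linarith
    · rw [hγ₀r t h]
      have h1 := hγx y z hyz (2 * t - 1) ⟨by linarith, by linarith [ht.2]⟩
      have h2 := dist_triangle (γ y z (2 * t - 1)) y x
      rw [dist_comm y x] at h2
      linarith
  have hfx : ∀ ζ, dist (f ζ) x ≤ 2 * r := by
    intro ζ
    obtain ⟨t, ht, h | h⟩ := hfmem ζ
    · rw [h]
      exact hγ₀x t ht
    · rw [h]
      have := hγx x z hxz t ht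
      linarith
  refine ⟨H, hH, fun s _ t _ => ?_, fun s _ => (hs0 s).trans h00, fun s _ => (hs1 s).trans h01,
    fun t ht => ?_, fun t ht => ?_, ht1⟩
  · obtain ⟨w, hw⟩ := hHF (s, t)
    have h1 := (le_iSup (fun w => infEDist (F w) (Set.range f)) w).trans_lt hFM
    obtain ⟨_, ⟨ζ, rfl⟩, hζ⟩ := infEDist_lt_iff.1 h1
    rw [edist_lt_ofReal] at hζ
    rw [← hw]
    have := dist_triangle (F w) (f ζ) x
    have := hfx ζ
    linarith
  · rw [ht0 t ⟨ht.1, by linarith [ht.2]⟩, hγ₀l t ht.2]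
  · rw [ht0 t ⟨by linarith [ht.1], ht.2⟩, hγ₀r t ht.1]

/-! ### Geometric actions -/

/-- Heredity is what permits the transfer: a filling with vertices in `o '' A` lifts vertex by
vertex to `A`. As `o` need not be injective, the values of `f` are kept on the boundary. -/
theorem IsAHA.of_coarse {X W : Type*} [MetricSpace X] [MetricSpace W] (hX : IsAHA X) (o : W → X)
    (h₁ : ∀ r : ℝ, 0 < r → ∃ r' : ℝ, 0 < r' ∧ ∀ a b, dist a b ≤ r → dist (o a) (o b) ≤ r')
    (h₂ : ∀ R : ℝ, ∃ R' : ℝ, 0 < R' ∧ ∀ a b, dist (o a) (o b) ≤ R → dist a b ≤ R') :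
    IsAHA W := by
  classical
  intro r hr
  obtain ⟨r', hr', hrr'⟩ := h₁ r hr
  obtain ⟨R, -, hRX⟩ := hX r' hr'
  obtain ⟨R', hR', hRR'⟩ := h₂ R
  refine ⟨R', hR', fun A i hi S f hS hf => ?_⟩
  obtain ⟨B, F, hB, hF, hFS⟩ := hRX (o '' A) i hi S (o ∘ f) hS (by
    intro s hs
    obtain ⟨-, k2, k3⟩ := hf s hs
    refine ⟨(face_nonempty hs).image _, ?_, ?_⟩
    · intro x hx
      obtain ⟨v, hv, rfl⟩ := Finset.mem_image.1 (Finset.mem_coe.1 hx)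
      exact ⟨f v, k2 (Finset.mem_coe.2 (Finset.mem_image_of_mem f hv)), rfl⟩
    · intro x hx y hy
      obtain ⟨u, hu, rfl⟩ := Finset.mem_image.1 hx
      obtain ⟨v, hv, rfl⟩ := Finset.mem_image.1 hy
      exact hrr' _ _ (k3 _ (Finset.mem_image_of_mem f hu) _ (Finset.mem_image_of_mem f hv)))
  have hex : ∀ v, ∃ a, F v ∈ o '' A → a ∈ A ∧ o a = F v := by
    intro v
    by_cases h : F v ∈ o '' A
    · obtain ⟨a, ha, hav⟩ := h
      exact ⟨a, fun _ => ⟨ha, hav⟩⟩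
    · exact ⟨f 0, fun h' => absurd h' h⟩
  choose a ha using hex
  let lab : ℕ → W := fun v => if {v} ∈ S.faces then f v else a v
  have hlab : ∀ t ∈ B.faces, ∀ v ∈ t, lab v ∈ A ∧ o (lab v) = F v := by
    intro t ht v hv
    by_cases hvS : {v} ∈ S.faces
    · simp only [lab, if_pos hvS]
      exact ⟨(hf _ hvS).2.1 (Finset.mem_coe.2 (Finset.mem_image_of_mem f (by simp))),
        (hFS v hvS).symm⟩
    · simp only [lab, if_neg hvS]
      exact ha v ((hF t ht).2.1 (Finset.mem_coe.2 (Finset.mem_image_of_mem F hv)))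
  refine ⟨B, lab, hB, fun t ht => ⟨(face_nonempty ht).image _, ?_, ?_⟩, fun v hv => if_pos hv⟩
  · intro x hx
    obtain ⟨v, hv, rfl⟩ := Finset.mem_image.1 (Finset.mem_coe.1 hx)
    exact (hlab t ht v hv).1
  · intro x hx y hy
    obtain ⟨u, hu, rfl⟩ := Finset.mem_image.1 hx
    obtain ⟨v, hv, rfl⟩ := Finset.mem_image.1 hy
    apply hRR'
    rw [(hlab t ht u hu).2, (hlab t ht v hv).2]
    exact (hF t ht).2.2 _ (Finset.mem_image_of_mem F hu) _ (Finset.mem_image_of_mem F hv)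

/-- Otherwise there are distinct `g` with points of `g K` ever closer to `K`; a subsequence of these
points converges. The sequence with its limit is compact and meets infinitely many translates of
`K`, against proper discontinuity. Local compactness is not needed. -/
theorem exists_finite_near_translates {G X : Type*} [Group G] [MetricSpace X] [MulAction G X]
    (hpd : ProperlyDiscontinuousSMul G X) {K : Set X} (hK : IsCompact K) :
    ∃ ε : ℝ, 0 < ε ∧ {g : G | ∃ x ∈ K, ∃ y ∈ K, dist (g • x) y < ε}.Finite := by
  classical
  by_contra! hinf
  let T : ℕ → Set G := fun n => {g : G | ∃ x ∈ K, ∃ y ∈ K, dist (g • x) y < 1 / ((n : ℝ) + 1)}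
  have hT : ∀ n, (T n).Infinite := fun n => hinf _ (by positivity)
  obtain ⟨u, hu, hur⟩ := exists_seq_of_forall_finset_exists
    (fun p : ℕ × G => p.2 ∈ T p.1) (fun p q => p.1 < q.1 ∧ p.2 ≠ q.2) (by
      intro s _
      obtain ⟨g, hg, hgs⟩ := (hT (s.sup Prod.fst + 1)).exists_notMem_finset (s.image Prod.snd)
      refine ⟨(s.sup Prod.fst + 1, g), hg, fun p hp => ⟨?_, ?_⟩⟩
      · exact Nat.lt_succ_of_le (Finset.le_sup (f := Prod.fst) hp)
      · rintro rfl
        exact hgs (Finset.mem_image_of_mem _ hp))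
  have hmono : StrictMono fun k => (u k).1 := fun m n hmn => (hur m n hmn).1
  have hinj : Function.Injective fun k => (u k).2 := by
    intro m n hmn
    by_contra hne
    rcases lt_or_gt_of_ne hne with h | h
    · exact (hur m n h).2 hmn
    · exact (hur n m h).2 hmn.symm
  choose x hx y hy hxy using hu
  obtain ⟨z, -, φ, hφ, hz⟩ := hK.tendsto_subseq hy
  have hlim : Filter.Tendsto (fun k => (u (φ k)).2 • x (φ k)) Filter.atTop (nhds z) := by
    refine hz.congr_dist (squeeze_zero (fun _ => dist_nonneg) (fun k => ?_)
      (tendsto_one_div_add_atTop_nhds_zero_nat (𝕜 := ℝ)))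
    rw [Function.comp_apply, dist_comm]
    refine (hxy (φ k)).le.trans (one_div_le_one_div_of_le (by positivity) ?_)
    have : k ≤ (u (φ k)).1 := (hφ.id_le k).trans (hmono.id_le _)
    have : (k : ℝ) ≤ (u (φ k)).1 := by exact_mod_cast this
    linarith
  have hfin := hpd.finite_disjoint_inter_image hK hlim.isCompact_insert_range
  refine Set.infinite_of_injective_forall_mem (hinj.comp hφ.injective) (fun k => ?_) hfin
  have : (u (φ k)).2 • x (φ k) ∈ ((u (φ k)).2 • ·) '' K ∩
      insert z (Set.range fun k => (u (φ k)).2 • x (φ k)) :=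
    ⟨⟨x (φ k), hx _, rfl⟩, Or.inr ⟨k, rfl⟩⟩
  exact ⟨_, this⟩

/-- Walking along a geodesic in steps of at most `ε / 2`, consecutive points lie in translates of
`K` that differ by an element of `U`. After `n` steps only products of `n` elements of `U` have
occurred. -/
theorem IsGeometricAction.exists_finite_cover {G X : Type*} [Group G] [MetricSpace X]
    [MulAction G X] (hgeod : IsGeodesicSpace X) (h : IsGeometricAction G X) {K : Set X}
    (hKG : ∀ x : X, ∃ g : G, ∃ y ∈ K, g • y = x) {ε : ℝ} (hε : 0 < ε) {U : Set G}
    (hU : U = {g : G | ∃ x ∈ K, ∃ y ∈ K, dist (g • x) y < ε}) (hUfin : U.Finite) (n : ℕ) :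
    ∃ F : Set G, F.Finite ∧ F ⊆ Subgroup.closure U ∧
      ∀ y, ∀ k ∈ K, dist k y ≤ n * (ε / 2) → ∃ g ∈ F, ∃ k ∈ K, g • k = y := by
  induction n with
  | zero =>
    refine ⟨{1}, Set.finite_singleton 1, by simp, fun y k hk hky => ⟨1, rfl, k, hk, ?_⟩⟩
    rw [one_smul]
    refine dist_le_zero.1 (hky.trans ?_)
    simp
  | succ n ih =>
    obtain ⟨F, hF, hFU, hFK⟩ := ih
    refine ⟨Set.image2 (· * ·) F U, hF.image2 _ hUfin, ?_, fun y k hk hky => ?_⟩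
    · rintro _ ⟨g, hg, u, hu, rfl⟩
      exact mul_mem (hFU hg) (Subgroup.subset_closure hu)
    · obtain ⟨γ, -, hγ0, hγ1, hγ⟩ := exists_constantSpeed_path hgeod k y
      have hn : (0 : ℝ) < n + 1 := by positivity
      -- Cutting here leaves a last piece of length at most `ε / 2`, strictly less than `ε`.
      have hmem : (n : ℝ) / (n + 1) ∈ Set.Icc (0 : ℝ) 1 :=
        ⟨by positivity, div_le_one_of_le₀ (by linarith) hn.le⟩
      push_cast at hky
      have h1 : dist k (γ (n / (n + 1))) ≤ n * (ε / 2) := by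
        conv_lhs => rw [← hγ0]
        rw [hγ 0 (by simp) _ hmem, zero_sub, abs_neg, abs_of_nonneg hmem.1, mul_div_assoc',
          div_le_iff₀ hn]
        have : (0 : ℝ) ≤ n := Nat.cast_nonneg n
        nlinarith
      have h2 : dist (γ (n / (n + 1))) y < ε := by
        conv_lhs => rw [← hγ1]
        rw [hγ _ hmem 1 (by simp)]
        have : |(n : ℝ) / (n + 1) - 1| = 1 / (n + 1) := by
          rw [abs_sub_comm, abs_of_nonneg (sub_nonneg.2 hmem.2)]
          field_simp
          ring
        rw [this, mul_one_div, div_lt_iff₀ hn]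
        nlinarith
      obtain ⟨g, hg, k', hk', hgk⟩ := hFK _ k hk h1
      obtain ⟨g', k'', hk'', hgk'⟩ := hKG y
      refine ⟨g', ⟨g, hg, g⁻¹ * g', ?_, by simp⟩, k'', hk'', hgk'⟩
      rw [hU]
      refine ⟨k'', hk'', k', hk', ?_⟩
      rw [← h.isometric g, mul_smul, smul_inv_smul, hgk', hgk, dist_comm]
      exact h2

/-- If `g • x₀` lies in `g' • K`, then `g'⁻¹ * g` moves `x₀` into `K` and so belongs to `U`. Thus
finite covers of balls by translates become finiteness of orbit points counted in `G`, and `U`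
generates. -/
theorem IsGeometricAction.finiteness {G X : Type*} [Group G] [MetricSpace X] [Nonempty X]
    [MulAction G X] (hgeod : IsGeodesicSpace X) (h : IsGeometricAction G X) :
    ∃ (x₀ : X) (c : ℝ), (∀ x, ∃ g : G, dist x (g • x₀) ≤ c) ∧ Group.FG G ∧
      ∀ ρ : ℝ, {g : G | dist x₀ (g • x₀) ≤ ρ}.Finite := by
  obtain ⟨K, hK, hKG⟩ := h.cocompact
  obtain ⟨-, x₀, hx₀, -⟩ := hKG (Classical.arbitrary X)
  obtain ⟨ε, hε, hUfin⟩ := exists_finite_near_translates h.properlyDiscontinuous hK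
  obtain ⟨U, hU⟩ : ∃ U : Set G, U = {g : G | ∃ x ∈ K, ∃ y ∈ K, dist (g • x) y < ε} := ⟨_, rfl⟩
  rw [← hU] at hUfin
  have key : ∀ ρ : ℝ, ∃ F : Set G, F.Finite ∧ F ⊆ Subgroup.closure U ∧
      ∀ g : G, dist x₀ (g • x₀) ≤ ρ → g ∈ F := by
    intro ρ
    obtain ⟨n, hn⟩ := exists_nat_ge (ρ / (ε / 2))
    rw [div_le_iff₀ (half_pos hε)] at hn
    obtain ⟨F, hF, hFU, hFK⟩ := h.exists_finite_cover hgeod hKG hε hU hUfin n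
    refine ⟨Set.image2 (· * ·) F U, hF.image2 _ hUfin, ?_, fun g hg => ?_⟩
    · rintro _ ⟨g, hg, u, hu, rfl⟩
      exact mul_mem (hFU hg) (Subgroup.subset_closure hu)
    · obtain ⟨g', hg', k, hk, hgk⟩ := hFK (g • x₀) x₀ hx₀ (hg.trans hn)
      refine ⟨g', hg', g'⁻¹ * g, ?_, by simp⟩
      rw [hU]
      refine ⟨x₀, hx₀, k, hk, ?_⟩
      rwa [mul_smul, ← hgk, inv_smul_smul, dist_self]
  obtain ⟨c, hc⟩ := hK.isBounded.subset_closedBall x₀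
  refine ⟨x₀, c, fun x => ?_, ?_, fun ρ => ?_⟩
  · obtain ⟨g, y, hy, rfl⟩ := hKG x
    refine ⟨g, ?_⟩
    rw [h.isometric]
    exact hc hy
  · rw [Group.fg_iff]
    refine ⟨U, (Subgroup.eq_top_iff' _).2 fun g => ?_, hUfin⟩
    obtain ⟨F, -, hFU, hF⟩ := key (dist x₀ (g • x₀))
    exact hFU (hF g le_rfl)
  · obtain ⟨F, hF, -, hFg⟩ := key ρ
    exact hF.subset fun g hg => hFg g hg

/-! ### Equivariant fillings -/

/-- In a simply connected space two paths with the same endpoints are homotopic. -/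
theorem exists_homotopy_of_simplyConnected {X : Type*} [TopologicalSpace X]
    [SimplyConnectedSpace X] {γ₀ γ₁ : ℝ → X} (h₀ : Continuous γ₀) (h₁ : Continuous γ₁)
    (hzero : γ₀ 0 = γ₁ 0) (hone : γ₀ 1 = γ₁ 1) :
    ∃ H : ℝ × ℝ → X, Continuous H ∧ (∀ s, H (s, 0) = γ₀ 0) ∧ (∀ s, H (s, 1) = γ₀ 1) ∧
      (∀ t ∈ Set.Icc (0 : ℝ) 1, H (0, t) = γ₀ t) ∧
      ∀ t ∈ Set.Icc (0 : ℝ) 1, H (1, t) = γ₁ t := by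
  let p₀ : Path (γ₀ 0) (γ₀ 1) :=
    ⟨⟨fun t => γ₀ t, h₀.comp continuous_subtype_val⟩, by simp, by simp⟩
  let p₁ : Path (γ₀ 0) (γ₀ 1) :=
    ⟨⟨fun t => γ₁ t, h₁.comp continuous_subtype_val⟩, by simp [hzero], by simp [hone]⟩
  obtain ⟨h⟩ := SimplyConnectedSpace.paths_homotopic p₀ p₁
  let π : ℝ → unitInterval := Set.projIcc (0 : ℝ) 1 zero_le_one
  have hπ : Continuous π := continuous_projIcc
  have hπ0 : π 0 = 0 := Set.projIcc_left _
  have hπ1 : π 1 = 1 := Set.projIcc_right _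
  have hπt : ∀ t ∈ Set.Icc (0 : ℝ) 1, (π t : ℝ) = t := fun t ht => by
    simp only [π, Set.projIcc_of_mem _ ht]
  refine ⟨fun z => h (π z.1, π z.2), ?_, fun s => ?_, fun s => ?_, fun t ht => ?_, fun t ht => ?_⟩
  · exact h.continuous.comp ((hπ.comp continuous_fst).prodMk (hπ.comp continuous_snd))
  · simp only [hπ0]
    exact h.source _
  · simp only [hπ1]
    exact h.target _
  · simp only [hπ0]
    rw [h.apply_zero]
    change γ₀ (π t) = _
    rw [hπt t ht]
  · simp only [hπ1]
    rw [h.apply_one]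
    change γ₁ (π t) = _
    rw [hπt t ht]

theorem exists_bound_of_finite {α : Type*} {F : Set α} (hF : F.Finite) (B : α → ℝ) :
    ∃ M : ℝ, ∀ a ∈ F, B a ≤ M := by
  obtain ⟨M, hM⟩ := (hF.image B).bddAbove
  exact ⟨M, fun a ha => hM (Set.mem_image_of_mem B ha)⟩

/-- Each `x` is approximated by an orbit point `q x • x₀`, and paths and fillings are chosen once
for each relative position and then translated. A triangle depends, up to translation, only on `(q
x)⁻¹ * q y` and `(q y)⁻¹ * q z`. Both range over a finite set, so a maximum of finitely many bounds
serves as `C`. -/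
theorem IsGeometricAction.exists_fillings {G X : Type*} [Group G] [MetricSpace X]
    [SimplyConnectedSpace X] [MulAction G X] (hgeod : IsGeodesicSpace X)
    (h : IsGeometricAction G X) (r : ℝ) : ∃ C, Nonempty (Fillings X r C) := by
  obtain ⟨x₀, c, hc, -, hfin⟩ := h.finiteness hgeod
  have hsmul : ∀ g : G, Continuous fun x : X => g • x := fun g =>
    (Isometry.of_dist_eq (h.isometric g)).continuous
  choose q hq using hc
  have hpath : ∀ g : G, ∃ γ : ℝ → X, Continuous γ ∧ γ 0 = x₀ ∧ γ 1 = g • x₀ := fun g => by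
    obtain ⟨γ, h1, h2, h3, -⟩ := exists_constantSpeed_path hgeod x₀ (g • x₀)
    exact ⟨γ, h1, h2, h3⟩
  choose P hP hP0 hP1 using hpath
  have hPB : ∀ g, ∃ B, ∀ t ∈ Set.Icc (0 : ℝ) 1, dist (P g t) x₀ ≤ B := fun g => by
    obtain ⟨B, hB⟩ := (isCompact_Icc.image (hP g)).isBounded.subset_closedBall x₀
    exact ⟨B, fun t ht => hB ⟨t, ht, rfl⟩⟩
  choose B hB using hPB
  have hhom : ∀ k : G × G, ∃ H : ℝ × ℝ → X, Continuous H ∧ (∀ s, H (s, 0) = x₀) ∧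
      (∀ s, H (s, 1) = (k.1 * k.2) • x₀) ∧
      (∀ t ∈ Set.Icc (0 : ℝ) (1 / 2), H (0, t) = P k.1 (2 * t)) ∧
      (∀ t ∈ Set.Icc (1 / 2 : ℝ) 1, H (0, t) = k.1 • P k.2 (2 * t - 1)) ∧
      (∀ t ∈ Set.Icc (0 : ℝ) 1, H (1, t) = P (k.1 * k.2) t) ∧
      ∃ B, ∀ s ∈ Set.Icc (0 : ℝ) 1, ∀ t ∈ Set.Icc (0 : ℝ) 1, dist (H (s, t)) x₀ ≤ B := by
    rintro ⟨k, l⟩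
    let γ : ℝ → X := fun t => if t ≤ 1 / 2 then P k (2 * t) else k • P l (2 * t - 1)
    have hγl : ∀ t, t ≤ 1 / 2 → γ t = P k (2 * t) := fun t ht => if_pos ht
    have hγr : ∀ t, 1 / 2 ≤ t → γ t = k • P l (2 * t - 1) := fun t ht => by
      rcases eq_or_lt_of_le ht with rfl | h
      · rw [hγl _ le_rfl]
        norm_num [hP0, hP1]
      · exact if_neg (not_le.2 h)
    have hγc : Continuous γ := by
      refine Continuous.if_le ((hP k).comp (by fun_prop))
        ((hsmul k).comp ((hP l).comp (by fun_prop))) continuous_id continuous_const fun t ht => ?_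
      rw [ht]
      norm_num [hP0, hP1]
    have hγ0 : γ 0 = x₀ := by rw [hγl 0 (by norm_num), mul_zero, hP0]
    have hγ1 : γ 1 = (k * l) • x₀ := by
      rw [hγr 1 (by norm_num), show (2 : ℝ) * 1 - 1 = 1 by norm_num, hP1, mul_smul]
    obtain ⟨H, hH, hs0, hs1, ht0, ht1⟩ := exists_homotopy_of_simplyConnected hγc (hP (k * l))
      (by rw [hγ0, hP0]) (by rw [hγ1, hP1])
    obtain ⟨M, hM⟩ := ((isCompact_Icc (a := (0 : ℝ)) (b := 1)).prod
      (isCompact_Icc (a := (0 : ℝ)) (b := 1))).image hH |>.isBounded.subset_closedBall x₀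
    refine ⟨H, hH, fun s => (hs0 s).trans hγ0, fun s => (hs1 s).trans hγ1, fun t ht => ?_,
      fun t ht => ?_, ht1, M, fun s hs t ht => hM ⟨(s, t), ⟨hs, ht⟩, rfl⟩⟩
    · rw [ht0 t ⟨ht.1, by linarith [ht.2]⟩, hγl t ht.2]
    · rw [ht0 t ⟨by linarith [ht.1], ht.2⟩, hγr t ht.1]
  choose H hH hs0 hs1 hl hr ht B' hB' using hhom
  -- Points at distance at most `r` have approximating orbit points at distance at most `r + 2 * c`.
  have hF := hfin (r + 2 * c)
  set F := {g : G | dist x₀ (g • x₀) ≤ r + 2 * c} with hFdef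
  obtain ⟨M, hM⟩ := exists_bound_of_finite hF B
  obtain ⟨M', hM'⟩ := exists_bound_of_finite (hF.prod hF) B'
  have hqF : ∀ x y, dist x y ≤ r → (q x)⁻¹ * q y ∈ F := by
    intro x y hxy
    change dist x₀ (((q x)⁻¹ * q y) • x₀) ≤ _
    rw [← h.isometric (q x), mul_smul, smul_inv_smul]
    have h1 := dist_triangle4 (q x • x₀) x y (q y • x₀)
    rw [dist_comm (q x • x₀) x] at h1
    have h2 := hq x
    have h3 := hq y
    linarith
  have hnear : ∀ (x z : X) (b : ℝ), dist z x₀ ≤ b → b ≤ max M M' →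
      dist (q x • z) x ≤ max M M' + c := by
    intro x z b hz hb
    have h1 := dist_triangle (q x • z) (q x • x₀) x
    rw [h.isometric] at h1
    have h2 := hq x
    rw [dist_comm] at h2
    linarith
  refine ⟨max M M' + c, ⟨⟨fun x => q x • x₀, fun x y t => q x • P ((q x)⁻¹ * q y) t,
    fun x y => (hsmul _).comp (hP _), fun x y => ?_, fun x y => ?_, fun x y hxy t ht => ?_,
    fun x y z hxy hyz hxz => ?_⟩⟩⟩
  · simp only [hP0]
  · simp only [hP1, mul_smul, smul_inv_smul]
  · exact hnear x _ _ (hB _ t ht) ((hM _ (hqF x y hxy)).trans (le_max_left _ _))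
  · set k := (q x)⁻¹ * q y with hk
    set l := (q y)⁻¹ * q z with hl'
    have hkl : k * l = (q x)⁻¹ * q z := by simp [hk, hl', mul_assoc]
    refine ⟨fun w => q x • H (k, l) w, (hsmul _).comp (hH _), fun s hs t ht' => ?_,
      fun s _ => ?_, fun s _ => ?_, fun t ht' => ?_, fun t ht' => ?_, fun t ht' => ?_⟩
    · exact hnear x _ _ (hB' (k, l) s hs t ht')
        ((hM' (k, l) ⟨hqF x y hxy, hqF y z hyz⟩).trans (le_max_right _ _))
    · simp only [hs0]
    · simp only [hs1, hkl, mul_smul, smul_inv_smul]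
    · simp only [hl (k, l) t ht']
    · simp only [hr (k, l) t ht']
      rw [hk, mul_smul, smul_inv_smul]
    · simp only [ht (k, l) t ht', hkl]

/-! ### Orbit maps and the word metric -/

theorem dist_smul_le_length {G X : Type*} [Group G] [MetricSpace X] [MulAction G X]
    (hiso : ∀ (g : G) (x y : X), dist (g • x) (g • y) = dist x y) {S : Set G} (x₀ : X) {M : ℝ}
    (hM : ∀ s ∈ S, dist x₀ (s • x₀) ≤ M) (l : List G) (hl : ∀ x ∈ l, x ∈ S ∨ x⁻¹ ∈ S) :
    dist x₀ (l.prod • x₀) ≤ l.length * M := by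
  induction l with
  | nil => simp
  | cons g l ih =>
    have h1 : dist x₀ (g • x₀) ≤ M := by
      rcases hl g (by simp) with h | h
      · exact hM g h
      · have := hM _ h
        rwa [← hiso g, smul_inv_smul, dist_comm] at this
    have h2 := ih fun x hx => hl x (by simp [hx])
    rw [List.prod_cons, mul_smul]
    have h3 := dist_triangle x₀ (g • x₀) (g • l.prod • x₀)
    rw [hiso] at h3
    push_cast [List.length_cons]
    linarith

/-- The orbit map is Lipschitz, since there are finitely many generators. Conversely, only finitely
many elements move `x₀` by at most `R`, so their word lengths are bounded. `IsAHA.of_coarse`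
applies. -/
theorem IsGeometricAction.isAHAGroup {G X : Type*} [Group G] [MetricSpace X] [Nonempty X]
    [MulAction G X] (hgeod : IsGeodesicSpace X) (h : IsGeometricAction G X) (hX : IsAHA X) :
    IsAHAGroup G := by
  obtain ⟨x₀, -, -, hFG, hfin⟩ := h.finiteness hgeod
  refine ⟨hFG, fun S hS => ?_⟩
  have hdist : ∀ a b : G, dist (a • x₀) (b • x₀) = dist x₀ ((a⁻¹ * b) • x₀) := fun a b => by
    rw [← h.isometric a x₀, mul_smul, smul_inv_smul]
  let _ := wordMetricSpace (S : Set G) hS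
  have hword : ∀ a b : G, dist a b = wordLength (S : Set G) (a⁻¹ * b) := fun _ _ => rfl
  refine hX.of_coarse (fun g => g • x₀) (fun r hr => ?_) fun R => ?_
  · obtain ⟨M, hM⟩ := exists_bound_of_finite S.finite_toSet fun s => dist x₀ (s • x₀)
    refine ⟨r * max M 0 + 1, by positivity, fun a b hab => ?_⟩
    obtain ⟨l, h1, h2, h3⟩ := exists_word hS (a⁻¹ * b)
    have h4 := dist_smul_le_length h.isometric x₀ (fun s hs => (hM s hs).trans (le_max_left M 0))
      l h2
    rw [hword, ← h1] at hab
    rw [hdist, ← h3]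
    have h5 : (l.length : ℝ) * max M 0 ≤ r * max M 0 :=
      mul_le_mul_of_nonneg_right hab (le_max_right _ _)
    linarith
  · obtain ⟨M, hM⟩ := exists_bound_of_finite (hfin R) fun g => (wordLength (S : Set G) g : ℝ)
    refine ⟨max M 0 + 1, by positivity, fun a b hab => ?_⟩
    rw [hdist] at hab
    have := hM _ hab
    have := le_max_left M 0
    rw [hword]
    linarith

/-! ### Conclusion -/

theorem theoremA {X : Type*} [MetricSpace X] [SimplyConnectedSpace X]
    (hgeod : IsGeodesicSpace X) (Y : Set X → Set X) (D : ℝ)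
    (hsub : ∀ A : Set X, A ⊆ Y A)
    (hnear : ∀ A : Set X, Y A ⊆ Metric.cthickening D A)
    (hasph : ∀ A : Set X, IsAspherical (Y A))
    (hmono : ∀ A₁ A₂ : Set X, A₁ ⊆ A₂ → Y A₁ ⊆ Y A₂) :
    ((∀ r : ℝ, 0 < r → fillRad X r < ⊤) → IsAHA X) ∧
    (∀ (G : Type*) [Group G] [MulAction G X] [Topology.CWComplex (Set.univ : Set X)],
      IsGeometricAction G X → (∀ A : Set X, IsSubcomplex (Y A)) → IsAHA X ∧ IsAHAGroup G) := by
  have : Nonempty X := PathConnectedSpace.nonempty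
  refine ⟨fun hfill => ?_, fun G _ _ _ hG _ => ?_⟩
  · exact isAHA_of_fillings hsub hnear hasph hmono fun r hr =>
      exists_fillings_of_fillRad hgeod hr (hfill _ (by positivity))
  · have hX : IsAHA X := isAHA_of_fillings hsub hnear hasph hmono fun r _ =>
      hG.exists_fillings hgeod r
    exact ⟨hX, hG.isAHAGroup hgeod hX⟩
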